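/- \textbf{Setting.} Let $\mathbb F$ be a field, $R=\mathbb F[x_1,\dots,x_n]$, let $\prec$ be an admissible ordering (a monomial well-ordering compatible with multiplication), and let $\mathrm{lt}(p)$, $\mathrm{lc}(p)$ denote the head monomial and head coefficient of $p\in R\setminus\{0\}$. A \emph{Gr\"obner basis} of an ideal $I$ is a finite set $G\subseteq I$ with $\langle G\rangle=I$ such that for every nonzero $p\in I$ some nonzero $g\in G$ satisfies $\mathrm{lt}(g)\mid\mathrm{lt}(p)$. Put $\mathrm{lt}_{p,q}=\mathrm{lcm}(\mathrm{lt}(p),\mathrm{lt}(q))/\mathrm{lt}(p)$ and $\mathrm{Spol}(p,q)=\mathrm{lc}(q)\,\mathrm{lt}_{p,q}\,p-\mathrm{lc}(p)\,\mathrm{lt}_{q,p}\,q$. A \emph{signature} is $\mu\mathbf e_\nu$ with $\mu$ a monomial and $\nu\ge1$; $u\cdot\mu\mathbf e_\nu=(u\mu)\mathbf e_\nu$; and $\mu\mathbf e_\nu\prec\mu'\mathbf e_{\nu'}$ iff $\nu<\nu'$, or $\nu=\nu'$ and $\mu\prec\mu'$. \textbf{The algorithm F5C.} The global data are a list $r$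 of labeled polynomials $r_k=(\mathrm{sig}(k),\mathrm{poly}(k))$, with $\#r$ its length, and a list of lists $\mathrm{Rules}_1,\mathrm{Rules}_2,\dots$ of pairs (monomial, index). \emph{AddRule}$(\mu\mathbf e_\nu,k)$ appends $(\mu,k)$ to $\mathrm{Rules}_\nu$. For $\mathrm{sig}(k)=\mu\mathbf e_\nu$, the pair $(u,k)$ is \emph{rewritable} if the last entry $(\mu',j)$ of $\mathrm{Rules}_\nu$ with $\mu'\mid u\mu$ exists and has $j\ne k$. For a set $P'$ of indices, a monomial is \emph{top-reducible by $P'$} if it is divisible by $\mathrm{lt}(\mathrm{poly}(\ell))$ for some $\ell\in P'$. \emph{Main loop.} The input is a list of nonzero homogeneous polynomials. Sort it by increasing total degree, ties by increasing head monomial, to $f_1,\dots,f_m$ ($m\ge1$). Put $r=((\mathbf e_1,f_1/\mathrm{lc}(f_1)))$, $\mathrm{Rules}=(())$, $P'=\{1\}$, $B=\{f_1\}$. For $i=2,\dots,m$: append $(\mathbf e_{\#r+1},f_i/\mathrm{lc}(f_i))$ to $r$; let $C$ be the result of Partial\_Basis on $(N,B,P')$ with $N=\#r$ (this is the call on input $i$);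 if $\mathrm{poly}(\lambda)=1$ for some $\lambda\in C$, return $\{1\}$; otherwise call SetupReducedBasis$(C)$, let $P'$ be its result and $B=\{\mathrm{poly}(\lambda):\lambda\in P'\}$. After the loop return $B$. \emph{SetupReducedBasis}$(C)$. Interreduce $\{\mathrm{poly}(\lambda):\lambda\in C\}$ (reduce elements by one another, dropping zeros, until no term of an element is divisible by the head monomial of another) and make the result monic; list it as $B_1,\dots,B_s$. Reset $r=((\mathbf e_j,B_j))_{j=1}^s$ and $\mathrm{Rules}_j=\big((\mathrm{lt}_{B_j,B_k},0)\big)_{k=1}^{j-1}$ for $j=1,\dots,s$, where $0$ is the index of a phantom polynomial. Return $\{1,\dots,s\}$. \emph{Partial\_Basis}$(N,B,P')$. Append $()$ to Rules; let $C=P'\cup\{N\}$ and $P=\bigcup_{j\in P'}\mathrm{CritPair}(N,j)$. While $P\neq\emptyset$: remove from $P$ the set $P_d$ of all $(t,k,u,\ell,v)$ in it with $\deg t=d$ minimal; let $S=\mathrm{SPols}(P_d)$ and $D=\mathrm{Reduction}(S)$; for each $k\in D$, add $\bigcup_{j\in C}\mathrm{CritPair}(k,j)$ to $P$ and then add $k$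 to $C$. Return $C$. \emph{CritPair}$(k,\ell)$. Let $p=\mathrm{poly}(k)$, $q=\mathrm{poly}(\ell)$, $u=\mathrm{lt}_{p,q}$, $v=\mathrm{lt}_{q,p}$. If $\mathrm{sig}(k)=\mu\mathbf e_N$ with $u\mu$ top-reducible by $P'$, or $\mathrm{sig}(\ell)=\mu\mathbf e_N$ with $v\mu$ top-reducible by $P'$, return $\emptyset$. Otherwise return $\{(\mathrm{lcm}(\mathrm{lt}(p),\mathrm{lt}(q)),k,u,\ell,v)\}$, with $(k,u)$ and $(\ell,v)$ swapped if $u\,\mathrm{sig}(k)\prec v\,\mathrm{sig}(\ell)$. \emph{SPols}$(P_d)$. For $(t,k,u,\ell,v)\in P_d$ in order of increasing $t$: if neither $(u,k)$ nor $(v,\ell)$ is rewritable, append $(u\,\mathrm{sig}(k),\mathrm{Spol}(\mathrm{poly}(k),\mathrm{poly}(\ell)))$ to $r$ and call AddRule$(u\,\mathrm{sig}(k),\#r)$. Return the new indices whose polynomial is nonzero. \emph{Reduction}$(S)$. Let $T=S$, $D=\emptyset$. While $T\ne\emptyset$: remove from $T$ an index $k$ of minimal signature; replace $\mathrm{poly}(k)$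 by its normal form (complete reduction) by $B$. If it is $0$, continue. Otherwise look for a $j\in C\cup D$ such that $\mathrm{lt}(\mathrm{poly}(j))$ divides $\mathrm{lt}(\mathrm{poly}(k))$ and, with $w=\mathrm{lt}(\mathrm{poly}(k))/\mathrm{lt}(\mathrm{poly}(j))$ and $\mathrm{sig}(j)=\mu\mathbf e_\nu$, $w\,\mathrm{sig}(j)\neq\mathrm{sig}(k)$, $(w,j)$ is not rewritable, and $w\mu$ is not top-reducible by $P'$. If there is none, make $\mathrm{poly}(k)$ monic and add $k$ to $D$. Otherwise take one such $j$ and let $p$ be $\mathrm{poly}(k)-\frac{\mathrm{lc}(\mathrm{poly}(k))}{\mathrm{lc}(\mathrm{poly}(j))}\,w\,\mathrm{poly}(j)$, made monic if nonzero. If $w\,\mathrm{sig}(j)\prec\mathrm{sig}(k)$, replace $\mathrm{poly}(k)$ by $p$ and put $k$ back into $T$; otherwise append $(w\,\mathrm{sig}(j),p)$ to $r$, call AddRule$(w\,\mathrm{sig}(j),\#r)$, and put $k$ and $\#r$ into $T$. Return $D$. \textbf{Theorem.} For every input of nonzero homogeneous polynomials, sorted to $f_1,\dots,f_m$, and for every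 execution of F5C (whatever choices are made where the above leaves an order, a tie or a choice open): \begin{enumerate} \item whenever the call of Partial\_Basis on input $i$ terminates, with result $C$, the set $\{\mathrm{poly}(\lambda):\lambda\in C\}$ is a Gr\"obner basis of $\langle f_1,\dots,f_i\rangle$; \item consequently, if F5C terminates, the set it returns is a Gr\"obner basis of $\langle f_1,\dots,f_m\rangle$. \end{enumerate} -/

import Mathlib

/-!
The algorithm F5C over a polynomial ring in `n` variables, written as an input-output relation.
A monomial is identified with its exponent vector, so that the product of monomials is `+`,
divisibility is `≤`, the least common multiple is `⊔` and the quotient is `-`; the head monomial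
of `p` is `ord.degree p` and its head coefficient is `ord.leadingCoeff p`.

Every choice that the pseudocode leaves open (the order in which a set is traversed, ties in a
sort) is left open here too: the relations below describe all executions.  A relation holds
only for executions that come to an end, after finitely many iterations of each loop.
-/

namespace F5C

open MvPolynomial

section

variable {n : ℕ} {K : Type*} [Field K]

/-- Monomials in `n` variables. -/
abbrev Mon (n : ℕ) := Fin n →₀ ℕ

/-- The signature `(μ, ν)` stands for `μ e_ν`; the indices `ν` start at `1`. -/
abbrev Sig (n : ℕ) := Mon n × ℕ

/-- The natural signature `u · sig` of a product. -/
noncomputable def Sig.mul (u : Mon n) (s : Sig n) : Sig n := (u + s.1, s.2)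

/-- The strict order of signatures: first by index, then by monomial. -/
def SigLT (ord : MonomialOrder (Fin n)) (s t : Sig n) : Prop :=
  s.2 < t.2 ∨ (s.2 = t.2 ∧ ord.toSyn s.1 < ord.toSyn t.1)

/-- `G` is a Gröbner basis of the ideal `I`. -/
def IsGroebnerBasis (ord : MonomialOrder (Fin n)) (G : Set (MvPolynomial (Fin n) K))
    (I : Ideal (MvPolynomial (Fin n) K)) : Prop :=
  G.Finite ∧ G ⊆ I ∧ Ideal.span G = I ∧
    ∀ p ∈ I, p ≠ 0 → ∃ g ∈ G, g ≠ 0 ∧ ord.degree g ≤ ord.degree p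

/-- The multiplier `lcm (lt p, lt q) / lt p`. -/
noncomputable def headMul (ord : MonomialOrder (Fin n)) (p q : MvPolynomial (Fin n) K) : Mon n :=
  ord.degree p ⊔ ord.degree q - ord.degree p

/-- Division by the head coefficient (`0` is sent to `0`). -/
noncomputable def makeMonic (ord : MonomialOrder (Fin n)) (p : MvPolynomial (Fin n) K) :
    MvPolynomial (Fin n) K :=
  C (ord.leadingCoeff p)⁻¹ * p

/-- One reduction step: `p'` arises from `p` by cancelling one of its terms (not necessarily the
head term) with a multiple of `q`. -/
def ReductionStep (ord : MonomialOrder (Fin n)) (q p p' : MvPolynomial (Fin n) K) : Prop :=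
  q ≠ 0 ∧ ∃ d ∈ p.support, ord.degree q ≤ d ∧
    p' = p - monomial (d - ord.degree q) (coeff d p / ord.leadingCoeff q) * q

/-- `h` is a normal form of `p` by `B`, the result of a complete reduction. -/
def IsNormalForm (ord : MonomialOrder (Fin n)) (B : Set (MvPolynomial (Fin n) K))
    (p h : MvPolynomial (Fin n) K) : Prop :=
  Relation.ReflTransGen (fun a b => ∃ q ∈ B, ReductionStep ord q a b) p h ∧
    ¬ ∃ h', ∃ q ∈ B, ReductionStep ord q h h'

/-- One step of an interreduction: an element of `P` is reduced by another one; the result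
replaces it, or the element is dropped when the result is `0`. -/
def InterreductionStep (ord : MonomialOrder (Fin n)) (P P' : Set (MvPolynomial (Fin n) K)) :
    Prop :=
  ∃ p ∈ P, ∃ q ∈ P, q ≠ p ∧ ∃ p', ReductionStep ord q p p' ∧
    P' = ((P \ {p}) ∪ {p'}) \ {0}

/-- `B` lists, without repetition and in some order, the monic polynomials of an interreduction
of `P`: the elements of `P` are reduced by one another until no reduction is possible. -/
def IsInterreduction (ord : MonomialOrder (Fin n)) (P : Set (MvPolynomial (Fin n) K))
    (B : List (MvPolynomial (Fin n) K)) : Prop :=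
  ∃ P', Relation.ReflTransGen (InterreductionStep ord) P P' ∧
    (¬ ∃ P'', InterreductionStep ord P' P'') ∧
    B.Nodup ∧ {b | b ∈ B} = makeMonic ord '' P'

/-- The two global variables: the list `r` of labeled polynomials, and the list of lists of
rewrite rules.  Both are indexed from `1` (see `entry`). -/
structure State (n : ℕ) (K : Type*) [Field K] where
  lp : List (Sig n × MvPolynomial (Fin n) K)
  rules : List (List (Mon n × ℕ))

/-- Access to a list whose indices start at `1`. -/
def entry {α : Type*} (l : List α) (dflt : α) : ℕ → α
  | 0 => dflt
  | k + 1 => l.getD k dflt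

namespace State

/-- The signature of the `k`-th labeled polynomial. -/
noncomputable def sig (st : State n K) (k : ℕ) : Sig n := (entry st.lp (0, 0) k).1

/-- The polynomial of the `k`-th labeled polynomial. -/
noncomputable def poly (st : State n K) (k : ℕ) : MvPolynomial (Fin n) K :=
  (entry st.lp (0, 0) k).2

/-- The number of labeled polynomials. -/
def size (st : State n K) : ℕ := st.lp.length

/-- Append a labeled polynomial. -/
def append (st : State n K) (s : Sig n) (p : MvPolynomial (Fin n) K) : State n K :=
  { st with lp := st.lp ++ [(s, p)] }

/-- Replace the `k`-th polynomial and keep its signature. -/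
noncomputable def setPoly (st : State n K) (k : ℕ) (p : MvPolynomial (Fin n) K) : State n K :=
  { st with lp := st.lp.set (k - 1) (st.sig k, p) }

/-- `Add_Rule`. -/
def addRule (st : State n K) (s : Sig n) (k : ℕ) : State n K :=
  { st with rules := st.rules.modify (s.2 - 1) (fun l => l ++ [(s.1, k)]) }

open Classical in
/-- `Find_Rewriting`: the index in the most recent rule whose monomial divides `u · sig k`,
and `k` itself if there is none. -/
noncomputable def findRewriting (st : State n K) (u : Mon n) (k : ℕ) : ℕ :=
  match (entry st.rules [] (st.sig k).2).reverse.find?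
      (fun ρ => decide (ρ.1 ≤ u + (st.sig k).1)) with
  | some ρ => ρ.2
  | none => k

/-- `Is_Rewritable`. -/
def Rewritable (st : State n K) (u : Mon n) (k : ℕ) : Prop := st.findRewriting u k ≠ k

/-- The monomial `t` is top-reducible by the polynomials with indices in `prev`. -/
def TopReducible (ord : MonomialOrder (Fin n)) (st : State n K) (prev : Finset ℕ) (t : Mon n) :
    Prop :=
  ∃ l ∈ prev, ord.degree (st.poly l) ≤ t

end State

/-- A critical pair `(t, k, u, l, v)`. -/
structure CritPair (n : ℕ) where
  t : Mon n
  k : ℕ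
  u : Mon n
  l : ℕ
  v : Mon n

open Classical in
/-- `Critical_Pair`: the empty set or one critical pair, whose first component has the larger
signature. -/
noncomputable def critPair (ord : MonomialOrder (Fin n)) (st : State n K) (k l i : ℕ)
    (prev : Finset ℕ) : Set (CritPair n) :=
  let t := ord.degree (st.poly k) ⊔ ord.degree (st.poly l)
  let u₁ := t - ord.degree (st.poly k)
  let u₂ := t - ord.degree (st.poly l)
  if (st.sig k).2 = i ∧ st.TopReducible ord prev (u₁ + (st.sig k).1) then ∅
  else if (st.sig l).2 = i ∧ st.TopReducible ord prev (u₂ + (st.sig l).1) then ∅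
  else if SigLT ord ((st.sig k).mul u₁) ((st.sig l).mul u₂) then {⟨t, l, u₂, k, u₁⟩}
  else {⟨t, k, u₁, l, u₂⟩}

open Classical in
/-- The body of the loop of `Spol`; the second entry of the pair is the set of indices of the
nonzero S-polynomials. -/
noncomputable def spolStep (ord : MonomialOrder (Fin n)) (a : State n K × Finset ℕ)
    (c : CritPair n) : State n K × Finset ℕ :=
  if ¬ a.1.Rewritable c.u c.k ∧ ¬ a.1.Rewritable c.v c.l then
    let s := ord.sPolynomial (a.1.poly c.k) (a.1.poly c.l)
    let sg := (a.1.sig c.k).mul c.u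
    let st₁ := a.1.append sg s
    (st₁.addRule sg st₁.size, if s = 0 then a.2 else a.2 ∪ {st₁.size})
  else a

/-- `Spol`: the critical pairs in `P` are treated from smallest to largest lcm.  The result is
kept as a set, since `Reduction` always selects an index of smallest signature. -/
def Spol (ord : MonomialOrder (Fin n)) (st : State n K) (P : Set (CritPair n))
    (st' : State n K) (S : Finset ℕ) : Prop :=
  ∃ L : List (CritPair n), L.Nodup ∧ (∀ c, c ∈ L ↔ c ∈ P) ∧
    L.Pairwise (fun c c' => ord.toSyn c.t ≤ ord.toSyn c'.t) ∧
    L.foldl (spolStep ord) (st, ∅) = (st', S)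

/-- The test of `Find_Reductor`: whether `j` may be returned as a reductor of `k`. -/
def IsReductor (ord : MonomialOrder (Fin n)) (st : State n K) (prev cur : Finset ℕ) (k j : ℕ) :
    Prop :=
  j ∈ cur ∧ ord.degree (st.poly j) ≤ ord.degree (st.poly k) ∧
    let u := ord.degree (st.poly k) - ord.degree (st.poly j)
    (st.sig j).mul u ≠ st.sig k ∧ ¬ st.Rewritable u j ∧
      ¬ st.TopReducible ord prev (u + (st.sig j).1)

/-- The multiplier `u = lt p / lt q` of a top-reduction of the `k`-th by the `j`-th polynomial. -/
noncomputable def topMul (ord : MonomialOrder (Fin n)) (st : State n K) (k j : ℕ) : Mon n :=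
  ord.degree (st.poly k) - ord.degree (st.poly j)

/-- The monic result of a top-reduction of the `k`-th by the `j`-th polynomial. -/
noncomputable def topReduce (ord : MonomialOrder (Fin n)) (st : State n K) (k j : ℕ) :
    MvPolynomial (Fin n) K :=
  makeMonic ord (st.poly k - monomial (topMul ord st k j)
    (ord.leadingCoeff (st.poly k) * (ord.leadingCoeff (st.poly j))⁻¹) * st.poly j)

/-- `Top_Reduction`: `TopReduction ord prev cur k st st' completed todo` says that the call for
`k` in the state `st` may end in the state `st'` and return `completed` and `todo`. -/
inductive TopReduction (ord : MonomialOrder (Fin n)) (prev cur : Finset ℕ) (k : ℕ)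
    (st : State n K) : State n K → Finset ℕ → Finset ℕ → Prop
  | zero : st.poly k = 0 → TopReduction ord prev cur k st st ∅ ∅
  | irreducible : st.poly k ≠ 0 → (¬ ∃ j, IsReductor ord st prev cur k j) →
      TopReduction ord prev cur k st (st.setPoly k (makeMonic ord (st.poly k))) {k} ∅
  | preserving (j : ℕ) : st.poly k ≠ 0 → IsReductor ord st prev cur k j →
      SigLT ord ((st.sig j).mul (topMul ord st k j)) (st.sig k) →
      TopReduction ord prev cur k st (st.setPoly k (topReduce ord st k j)) ∅ {k}
  | raising (j : ℕ) : st.poly k ≠ 0 → IsReductor ord st prev cur k j →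
      ¬ SigLT ord ((st.sig j).mul (topMul ord st k j)) (st.sig k) →
      TopReduction ord prev cur k st
        ((st.append ((st.sig j).mul (topMul ord st k j)) (topReduce ord st k j)).addRule
          ((st.sig j).mul (topMul ord st k j)) (st.size + 1))
        ∅ {k, st.size + 1}

/-- The loop of `Reduction`:
`ReductionLoop ord B prev cur st todo completed st' out` says that, from the state `st` with the
given values of `todo` and `completed`, the loop may end in the state `st'` and return `out`. -/
inductive ReductionLoop (ord : MonomialOrder (Fin n)) (B : Set (MvPolynomial (Fin n) K))
    (prev cur : Finset ℕ) : State n K → Finset ℕ → Finset ℕ → State n K → Finset ℕ → Prop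
  | done (st : State n K) (completed : Finset ℕ) :
      ReductionLoop ord B prev cur st ∅ completed st completed
  | step (st st₁ st' : State n K) (todo completed newly redo out : Finset ℕ) (k : ℕ)
      (h : MvPolynomial (Fin n) K) :
      k ∈ todo → (∀ j ∈ todo, ¬ SigLT ord (st.sig j) (st.sig k)) →
      IsNormalForm ord B (st.poly k) h →
      TopReduction ord prev (cur ∪ completed) k (st.setPoly k h) st₁ newly redo →
      ReductionLoop ord B prev cur st₁ (todo.erase k ∪ redo) (completed ∪ newly) st' out →
      ReductionLoop ord B prev cur st todo completed st' out

/-- `Reduction` of the polynomials with indices in `S`. -/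
def Reduction (ord : MonomialOrder (Fin n)) (B : Set (MvPolynomial (Fin n) K))
    (prev cur : Finset ℕ) (st : State n K) (S : Finset ℕ) (st' : State n K) (R : Finset ℕ) :
    Prop :=
  ReductionLoop ord B prev cur st S ∅ st' R

/-- The body of the `for` loop of `Partial_Basis`: form the critical pairs of `k` with the
current basis, then add `k` to it. -/
noncomputable def addIndex (ord : MonomialOrder (Fin n)) (st : State n K) (i : ℕ)
    (prev : Finset ℕ) (a : Set (CritPair n) × Finset ℕ) (k : ℕ) :
    Set (CritPair n) × Finset ℕ :=
  (a.1 ∪ ⋃ j ∈ a.2, critPair ord st k j i prev, a.2 ∪ {k})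

/-- The `while` loop of `Partial_Basis`:
`PartialBasisLoop ord i B prev st P cur st' out` says that, from the state `st` with the set `P`
of critical pairs and the current basis `cur`, the loop may end in the state `st'` with the
current basis `out`. -/
inductive PartialBasisLoop (ord : MonomialOrder (Fin n)) (i : ℕ)
    (B : Set (MvPolynomial (Fin n) K)) (prev : Finset ℕ) :
    State n K → Set (CritPair n) → Finset ℕ → State n K → Finset ℕ → Prop
  | done (st : State n K) (cur : Finset ℕ) : PartialBasisLoop ord i B prev st ∅ cur st cur
  | step (st st₁ st₂ st' : State n K) (P : Set (CritPair n)) (cur S R out : Finset ℕ) (d : ℕ)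
      (L : List ℕ) :
      IsLeast ((fun c : CritPair n => c.t.degree) '' P) d →
      Spol ord st {c ∈ P | c.t.degree = d} st₁ S →
      Reduction ord B prev cur st₁ S st₂ R →
      L.Nodup → L.toFinset = R →
      PartialBasisLoop ord i B prev st₂
        (L.foldl (addIndex ord st₂ i prev) (P \ {c ∈ P | c.t.degree = d}, cur)).1
        (L.foldl (addIndex ord st₂ i prev) (P \ {c ∈ P | c.t.degree = d}, cur)).2 st' out →
      PartialBasisLoop ord i B prev st P cur st' out

/-- `Partial_Basis`: the call with the arguments `i`, `B`, `prev` in the state `st` may end in the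
state `st'` and return the set of indices `out`. -/
def PartialBasis (ord : MonomialOrder (Fin n)) (i : ℕ) (B : Set (MvPolynomial (Fin n) K))
    (prev : Finset ℕ) (st st' : State n K) (out : Finset ℕ) : Prop :=
  let st₀ : State n K := { st with rules := st.rules ++ [[]] }
  PartialBasisLoop ord i B prev st₀ (⋃ j ∈ prev, critPair ord st₀ st.size j i prev)
    (prev ∪ {st.size}) st' out

/-- The polynomials with indices in `s`. -/
def State.polys (st : State n K) (s : Finset ℕ) : Set (MvPolynomial (Fin n) K) :=
  {p | ∃ k ∈ s, p = st.poly k}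

/-- The state that records the reduced basis `B`: the `j`-th element gets the signature `e_j`,
and the `j`-th list of rules consists of the multipliers of `B_j` in its S-polynomials with
`B_1, …, B_(j-1)`, each redirected to the phantom index `0`. -/
noncomputable def reducedState (ord : MonomialOrder (Fin n))
    (B : List (MvPolynomial (Fin n) K)) : State n K where
  lp := B.mapIdx fun j p => ((0, j + 1), p)
  rules := B.mapIdx fun j p => (B.take j).map fun q => (headMul ord p q, 0)

/-- `Setup_Reduced_Basis`: the call for `cur` in the state `st` may end in the state `st'` and
return `out`. -/
def SetupReducedBasis (ord : MonomialOrder (Fin n)) (cur : Finset ℕ) (st st' : State n K)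
    (out : Finset ℕ) : Prop :=
  ∃ B : List (MvPolynomial (Fin n) K), IsInterreduction ord (st.polys cur) B ∧
    st' = reducedState ord B ∧ out = Finset.Icc 1 B.length

/-- The state in which `Partial_Basis` is called: `(e_(#r+1), f / lc f)` is appended to `r`. -/
noncomputable def pushInput (ord : MonomialOrder (Fin n)) (st : State n K)
    (f : MvPolynomial (Fin n) K) : State n K :=
  st.append (0, st.size + 1) (makeMonic ord f)

/-- `AtLoop ord F i st prev B`: on the sorted input `F`, an execution of F5C may arrive at the
head of its `while` loop with these values of its variables. -/
inductive AtLoop (ord : MonomialOrder (Fin n)) (F : List (MvPolynomial (Fin n) K)) :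
    ℕ → State n K → Finset ℕ → Set (MvPolynomial (Fin n) K) → Prop
  | start (f₁ : MvPolynomial (Fin n) K) : F.head? = some f₁ →
      AtLoop ord F 2 ⟨[((0, 1), makeMonic ord f₁)], [[]]⟩ {1} {f₁}
  | next (i : ℕ) (st st₁ st₂ : State n K) (prev cur prev₂ : Finset ℕ)
      (B : Set (MvPolynomial (Fin n) K)) :
      AtLoop ord F i st prev B → i ≤ F.length →
      PartialBasis ord (st.size + 1) B prev (pushInput ord st (entry F 0 i)) st₁ cur →
      (¬ ∃ k ∈ cur, st₁.poly k = 1) →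
      SetupReducedBasis ord cur st₁ st₂ prev₂ →
      AtLoop ord F (i + 1) st₂ prev₂ (st₂.polys prev₂)

/-- `CallReturns ord F i st cur`: on the sorted input `F = (f₁, …, f_m)`, an execution of F5C may
arrive at the pass `i` of its `while` loop, with `i ≤ m`, and its call of `Partial_Basis` in this
pass may end in the state `st` and return `cur`. -/
def CallReturns (ord : MonomialOrder (Fin n)) (F : List (MvPolynomial (Fin n) K)) (i : ℕ)
    (st : State n K) (cur : Finset ℕ) : Prop :=
  ∃ st₀ prev B, AtLoop ord F i st₀ prev B ∧ i ≤ F.length ∧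
    PartialBasis ord (st₀.size + 1) B prev (pushInput ord st₀ (entry F 0 i)) st cur

/-- `G` is `F` sorted by increasing total degree, ties broken by increasing head monomial. -/
def IsSorting (ord : MonomialOrder (Fin n)) (F G : List (MvPolynomial (Fin n) K)) : Prop :=
  G.Perm F ∧ G.Pairwise fun p q => p.totalDegree < q.totalDegree ∨
    (p.totalDegree = q.totalDegree ∧ ord.toSyn (ord.degree p) ≤ ord.toSyn (ord.degree q))

/-- F5C on the sorted input `F` may terminate and return `G`. -/
inductive SortedReturns (ord : MonomialOrder (Fin n)) (F : List (MvPolynomial (Fin n) K)) :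
    Set (MvPolynomial (Fin n) K) → Prop
  | one (i : ℕ) (st : State n K) (cur : Finset ℕ) : CallReturns ord F i st cur →
      (∃ k ∈ cur, st.poly k = 1) → SortedReturns ord F {1}
  | finish (i : ℕ) (st : State n K) (prev : Finset ℕ) (B : Set (MvPolynomial (Fin n) K)) :
      AtLoop ord F i st prev B → ¬ i ≤ F.length → SortedReturns ord F B

/-- F5C on the input `F` may terminate and return `G`. -/
def Returns (ord : MonomialOrder (Fin n)) (F : List (MvPolynomial (Fin n) K))
    (G : Set (MvPolynomial (Fin n) K)) : Prop :=
  ∃ F', IsSorting ord F F' ∧ SortedReturns ord F' G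

end

end F5C

/-! Consider one call of Partial_Basis on `f` with index `N`, where the previous basis is a Gröbner
basis of `J`. Signatures are read modulo `J`: `p` has signature `μ` if `p ≡ a f` modulo `J` for some
`a` with head monomial `μ`. Such an `a` is not unique; in particular 0 has as signature the head
monomial of every nonzero `b ∈ J`, because `b f ∈ J`. S-polynomials, normal forms by the old basis
and top-reductions all respect this notion, so every labeled polynomial of index at least `N` really
has its recorded signature (`Inv`).

For a signature `σ` the two criteria leave at most one multiple. If `σ` is top-reducible, it is a
signature of 0 and nothing is left. Otherwise only the last created `g j` whose signature divides
`σ` may be used. By induction on `σ`, the head of any `p` of signature `σ` is divisible by an old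
head or is the head of an accepted multiple (`head_divisible`): subtract from `p` the multiple of
signature `σ` so that the signature drops. The only obstruction is that this multiple has a larger
head than `p`; then the difference has a smaller signature and that same larger head. By induction
the head is shared with an old multiple or with an accepted multiple of smaller signature.

Such a collision is impossible at the end of the call. Divide the two multiples by their common
factor: this gives a critical pair whose components still pass both criteria, since rejection is
inherited by multiples. But no pair is waiting any more, and every treated pair is rewritable: it
was so already, or its S-polynomial was recorded, and the rule added with that S-polynomial makes
the pair rewritable (`Inv.foldl_spolStep`). Thus no standard representation of S-polynomials is
needed. In a collision with the old basis one takes the old element of least index; the phantom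
rules do not reject it.

Between calls, interreduction keeps a Gröbner basis, and the reset rules have exactly the property
that the next call needs (`Records`). -/

namespace F5C

open MvPolynomial

/-! ### Signatures modulo `J` and the head-divisibility induction. -/

section Algebra

variable {n : ℕ} {K : Type*} [Field K] {ord : MonomialOrder (Fin n)}

/-- `p = a f + b` with `b ∈ J` and `μ` the head monomial of `a`. -/
def HasSig (ord : MonomialOrder (Fin n)) (J : Ideal (MvPolynomial (Fin n) K))
    (f : MvPolynomial (Fin n) K) (μ : Mon n) (p : MvPolynomial (Fin n) K) : Prop :=
  ∃ a, a ≠ 0 ∧ ord.degree a = μ ∧ p - a * f ∈ J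

/-- `p = a f + b` with `b ∈ J` and `a` zero or with head monomial smaller than `μ`. -/
def SigBelow (ord : MonomialOrder (Fin n)) (J : Ideal (MvPolynomial (Fin n) K))
    (f : MvPolynomial (Fin n) K) (μ : Mon n) (p : MvPolynomial (Fin n) K) : Prop :=
  ∃ a, (a = 0 ∨ ord.toSyn (ord.degree a) < ord.toSyn μ) ∧ p - a * f ∈ J

variable {J : Ideal (MvPolynomial (Fin n) K)} {f p q : MvPolynomial (Fin n) K} {μ ν : Mon n}

theorem degree_sub_of_lt (h : ord.toSyn (ord.degree q) < ord.toSyn (ord.degree p)) :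
    ord.degree (p - q) = ord.degree p := by
  rw [sub_eq_add_neg]
  exact MonomialOrder.degree_add_of_lt (by rwa [MonomialOrder.degree_neg])

theorem sub_ne_zero_of_lt (h : ord.toSyn (ord.degree q) < ord.toSyn (ord.degree p)) :
    p - q ≠ 0 := by
  intro h0
  rw [sub_eq_zero] at h0
  simp [h0] at h

theorem degree_monomial_mul {w : Mon n} {c : K} (hc : c ≠ 0) (hp : p ≠ 0) :
    ord.degree (monomial w c * p) = w + ord.degree p := by
  classical
  rw [MonomialOrder.degree_mul (by simpa using hc) hp, MonomialOrder.degree_monomial, if_neg hc]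

theorem monomial_mul_ne_zero {w : Mon n} {c : K} (hc : c ≠ 0) (hp : p ≠ 0) :
    monomial w c * p ≠ 0 :=
  mul_ne_zero (by simpa using hc) hp

theorem monomial_mul_sub (w : Mon n) (c : K) (a : MvPolynomial (Fin n) K) :
    monomial w c * p - monomial w c * a * f = monomial w c * (p - a * f) := by ring

theorem makeMonic_eq_zero : makeMonic ord p = 0 ↔ p = 0 := by
  simp [makeMonic]

theorem makeMonic_eq_monomial_mul : makeMonic ord p = monomial 0 (ord.leadingCoeff p)⁻¹ * p := rfl

theorem degree_makeMonic : ord.degree (makeMonic ord p) = ord.degree p := by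
  by_cases hp : p = 0
  · simp [hp, makeMonic]
  · rw [makeMonic_eq_monomial_mul, degree_monomial_mul _ hp, zero_add]
    simpa using hp

theorem makeMonic_mem (hp : p ∈ J) : makeMonic ord p ∈ J := J.mul_mem_left _ hp

theorem C_leadingCoeff_mul_makeMonic : C (ord.leadingCoeff p) * makeMonic ord p = p := by
  by_cases hp : p = 0
  · simp [hp, makeMonic]
  · rw [makeMonic, ← mul_assoc, ← C_mul, mul_inv_cancel₀ (by simpa using hp), C_1, one_mul]

theorem makeMonic_mem_iff : makeMonic ord p ∈ J ↔ p ∈ J :=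
  ⟨fun h => C_leadingCoeff_mul_makeMonic (ord := ord) (p := p) ▸ J.mul_mem_left _ h, makeMonic_mem⟩

theorem SigBelow.of_mem (hq : q ∈ J) : SigBelow ord J f μ q :=
  ⟨0, Or.inl rfl, by simpa using hq⟩

theorem HasSig.sigBelow (h : HasSig ord J f μ p) (hlt : ord.toSyn μ < ord.toSyn ν) :
    SigBelow ord J f ν p := by
  obtain ⟨a, -, rfl, hp⟩ := h
  exact ⟨a, Or.inr hlt, hp⟩

theorem HasSig.neg (h : HasSig ord J f μ p) : HasSig ord J f μ (-p) := by
  obtain ⟨a, ha, rfl, hp⟩ := h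
  refine ⟨-a, neg_ne_zero.2 ha, MonomialOrder.degree_neg, ?_⟩
  have := J.neg_mem hp
  convert this using 1
  ring

/-- The cofactor of `q` has no term that reaches `μ`, so the head of the cofactor of `p` survives.
-/
theorem HasSig.sub (h : HasSig ord J f μ p) (h' : SigBelow ord J f μ q) :
    HasSig ord J f μ (p - q) := by
  obtain ⟨a, ha, rfl, hp⟩ := h
  obtain ⟨b, hb, hq⟩ := h'
  have hmem : p - q - (a - b) * f ∈ J := by
    convert J.sub_mem hp hq using 1
    ring
  rcases hb with rfl | hb
  · exact ⟨a, ha, rfl, by simpa using hmem⟩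
  · exact ⟨a - b, sub_ne_zero_of_lt hb, degree_sub_of_lt hb, hmem⟩

theorem HasSig.sub_left (h : HasSig ord J f μ p) (h' : SigBelow ord J f μ q) :
    HasSig ord J f μ (q - p) := by
  simpa using (h.sub h').neg

theorem HasSig.monomial_mul (h : HasSig ord J f μ p) (w : Mon n) {c : K} (hc : c ≠ 0) :
    HasSig ord J f (w + μ) (monomial w c * p) := by
  obtain ⟨a, ha, hμ, hp⟩ := h
  refine ⟨monomial w c * a, monomial_mul_ne_zero hc ha, ?_, ?_⟩
  · rw [degree_monomial_mul hc ha, hμ]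
  · rw [monomial_mul_sub]
    exact J.mul_mem_left _ hp

theorem HasSig.makeMonic (h : HasSig ord J f μ p) : HasSig ord J f μ (makeMonic ord p) := by
  by_cases hp : p = 0
  · subst hp
    simpa [F5C.makeMonic] using h
  · simpa [makeMonic_eq_monomial_mul] using
      h.monomial_mul 0 (c := (ord.leadingCoeff p)⁻¹) (by simpa using hp)

/-- The scalar `c` is the quotient of the head coefficients of the cofactors, not of the
polynomials. With `q = 0` this says that a signature shared with 0 can be lowered. -/
theorem HasSig.cancel (hp : HasSig ord J f μ p) (hq : HasSig ord J f μ q) :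
    ∃ c : K, c ≠ 0 ∧ SigBelow ord J f μ (p - monomial 0 c * q) := by
  obtain ⟨a, ha, rfl, hp⟩ := hp
  obtain ⟨b, hb, hab, hq⟩ := hq
  have ha' : ord.leadingCoeff a ≠ 0 := by simpa using ha
  have hb' : ord.leadingCoeff b ≠ 0 := by simpa using hb
  set c := ord.leadingCoeff a / ord.leadingCoeff b
  have hc : c ≠ 0 := div_ne_zero ha' hb'
  have hmem : p - monomial 0 c * q - (a - monomial 0 c * b) * f ∈ J := by
    convert J.sub_mem hp (J.mul_mem_left (monomial 0 c) hq) using 1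
    ring
  refine ⟨c, hc, a - monomial 0 c * b, ?_, hmem⟩
  by_cases h0 : a - monomial 0 c * b = 0
  · exact Or.inl h0
  right
  refine lt_of_le_of_ne ?_ ?_
  · refine MonomialOrder.degree_sub_le.trans ?_
    rw [degree_monomial_mul hc hb, hab, zero_add, sup_idem]
  · intro he
    have he := ord.toSyn.injective he
    apply (MonomialOrder.coeff_degree_ne_zero_iff (m := ord)).2 h0
    rw [he, coeff_sub]
    have : coeff (ord.degree a) (monomial 0 c * b) = c * ord.leadingCoeff b := by
      rw [MonomialOrder.leadingCoeff, hab]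
      simp
    rw [this]
    change ord.leadingCoeff a - _ = 0
    simp only [c]
    field_simp
    simp

theorem HasSig.mem_sup (h : HasSig ord J f μ p) : p ∈ J ⊔ Ideal.span {f} := by
  obtain ⟨a, -, -, hp⟩ := h
  have hf : a * f ∈ J ⊔ Ideal.span {f} :=
    Ideal.mem_sup_right (Ideal.mul_mem_left _ a (Ideal.mem_span_singleton_self f))
  simpa using Ideal.add_mem _ (Ideal.mem_sup_left hp) hf

theorem mem_sup_cases (h : p ∈ J ⊔ Ideal.span {f}) : p ∈ J ∨ ∃ σ, HasSig ord J f σ p := by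
  obtain ⟨b, hb, c, hc, rfl⟩ := Submodule.mem_sup.1 h
  obtain ⟨a, rfl⟩ := Ideal.mem_span_singleton'.1 hc
  by_cases ha : a = 0
  · left
    simpa [ha] using hb
  · exact Or.inr ⟨_, a, ha, rfl, by simpa using hb⟩

/-- The monomial `t` is the head monomial of a multiple `v g_k`, with signature `τ`, that neither
the rewrite criterion nor the top-reduction criterion rejects. -/
def Admissible (ord : MonomialOrder (Fin n)) (g : ℕ → MvPolynomial (Fin n) K) (μ : ℕ → Mon n)
    (prev : Finset ℕ) (N M : ℕ) (τ t : Mon n) : Prop :=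
  ∃ k v, N ≤ k ∧ k ≤ M ∧ g k ≠ 0 ∧ v + ord.degree (g k) = t ∧ v + μ k = τ ∧
    (∀ i, k < i → i ≤ M → ¬ μ i ≤ τ) ∧ ∀ l ∈ prev, ¬ ord.degree (g l) ≤ τ

/-- Well-founded induction on `σ`. The hypotheses `hno` and `hno'` forbid collisions of heads
between accepted multiples and old multiples, and between accepted multiples of different
signatures. -/
theorem head_divisible {g : ℕ → MvPolynomial (Fin n) K} {μ : ℕ → Mon n} {prev : Finset ℕ}
    {N M : ℕ} (hNM : N ≤ M) (hμ : μ N = 0)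
    (hJ : ∀ b ∈ J, b ≠ 0 → ∃ l ∈ prev, ord.degree (g l) ≤ ord.degree b)
    (hprev : ∀ l ∈ prev, g l ∈ J ∧ g l ≠ 0)
    (hsig : ∀ j, N ≤ j → j ≤ M → HasSig ord J f (μ j) (g j))
    (hno : ∀ σ t, Admissible ord g μ prev N M σ t → ∀ l ∈ prev, ¬ ord.degree (g l) ≤ t)
    (hno' : ∀ σ τ t, Admissible ord g μ prev N M σ t → Admissible ord g μ prev N M τ t →
      ¬ ord.toSyn τ < ord.toSyn σ)
    (σ : Mon n) (p : MvPolynomial (Fin n) K) (hp : p ≠ 0) (hpσ : HasSig ord J f σ p) :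
    (∃ l ∈ prev, ord.degree (g l) ≤ ord.degree p) ∨
      ∃ τ, ord.toSyn τ ≤ ord.toSyn σ ∧ Admissible ord g μ prev N M τ (ord.degree p) := by
  induction hs : ord.toSyn σ using WellFoundedLT.induction generalizing σ p with
  | ind s ih =>
  subst hs
  have below : ∀ q, q ≠ 0 → SigBelow ord J f σ q →
      (∃ l ∈ prev, ord.degree (g l) ≤ ord.degree q) ∨
        ∃ τ, ord.toSyn τ < ord.toSyn σ ∧ Admissible ord g μ prev N M τ (ord.degree q) := by
    rintro q hq ⟨a, ha, haq⟩
    by_cases ha0 : a = 0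
    · left
      exact hJ q (by simpa [ha0] using haq) hq
    · have hlt := ha.resolve_left ha0
      rcases ih _ hlt (ord.degree a) q hq ⟨a, ha0, rfl, haq⟩ rfl with h | ⟨τ, hτ, h⟩
      · exact Or.inl h
      · exact Or.inr ⟨τ, hτ.trans_lt hlt, h⟩
  have below' : SigBelow ord J f σ p →
      (∃ l ∈ prev, ord.degree (g l) ≤ ord.degree p) ∨
        ∃ τ, ord.toSyn τ ≤ ord.toSyn σ ∧ Admissible ord g μ prev N M τ (ord.degree p) :=
    fun h => (below p hp h).imp id fun ⟨τ, hτ, h⟩ => ⟨τ, hτ.le, h⟩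
  have syz : HasSig ord J f σ 0 → SigBelow ord J f σ p := by
    intro h
    obtain ⟨c, -, hc⟩ := hpσ.cancel h
    simpa using hc
  by_cases htop : ∃ l ∈ prev, ord.degree (g l) ≤ σ
  · obtain ⟨l, hl, hle⟩ := htop
    apply below' (syz ?_)
    -- The Koszul syzygy: the cofactor `g l` gives `g l * f ∈ J`.
    have h0 : HasSig ord J f (ord.degree (g l)) 0 :=
      ⟨g l, (hprev l hl).2, rfl, by
        simpa using J.mul_mem_right f (hprev l hl).1⟩
    simpa [tsub_add_cancel_of_le hle] using
      h0.monomial_mul (σ - ord.degree (g l)) (one_ne_zero (α := K))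
  push Not at htop
  classical
  -- The largest index in `s` is the one that the rewrite criterion accepts; `s` contains `N`
  -- because the input has signature monomial 1.
  let s := (Finset.Icc N M).filter fun j => μ j ≤ σ
  have hs : s.Nonempty := ⟨N, by simp [s, hNM, hμ]⟩
  obtain ⟨hjI, hjσ⟩ := Finset.mem_filter.1 (s.max'_mem hs)
  have hjmax : ∀ i, s.max' hs < i → i ≤ M → ¬ μ i ≤ σ := by
    intro i hi hiM hiσ
    refine absurd (s.le_max' i ?_) (not_le.2 hi)
    simp only [s, Finset.mem_filter, Finset.mem_Icc]
    exact ⟨⟨(Finset.mem_Icc.1 hjI).1.trans hi.le, hiM⟩, hiσ⟩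
  generalize s.max' hs = j at hjI hjσ hjmax
  rw [Finset.mem_Icc] at hjI
  set w := σ - μ j with hw
  have hwσ : w + μ j = σ := tsub_add_cancel_of_le hjσ
  have hwg : HasSig ord J f σ (monomial w 1 * g j) :=
    hwσ ▸ (hsig j hjI.1 hjI.2).monomial_mul w one_ne_zero
  by_cases hgj : g j = 0
  · exact below' (syz (by simpa [hgj] using hwg))
  have hadm : Admissible ord g μ prev N M σ (w + ord.degree (g j)) :=
    ⟨j, w, hjI.1, hjI.2, hgj, rfl, hwσ, hjmax, htop⟩
  obtain ⟨c, hc, hlow⟩ := hpσ.cancel hwg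
  have hdeg : ord.degree (monomial 0 c * (monomial w 1 * g j)) = w + ord.degree (g j) := by
    rw [degree_monomial_mul hc (monomial_mul_ne_zero one_ne_zero hgj),
      degree_monomial_mul one_ne_zero hgj, zero_add]
  generalize monomial 0 c * (monomial w 1 * g j) = q at hdeg hlow
  rcases lt_trichotomy (ord.toSyn (ord.degree q)) (ord.toSyn (ord.degree p)) with h | h | h
  · have := below _ (sub_ne_zero_of_lt h) hlow
    rw [degree_sub_of_lt h] at this
    exact this.imp id fun ⟨τ, hτ, h⟩ => ⟨τ, hτ.le, h⟩
  · right
    refine ⟨σ, le_rfl, ?_⟩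
    rwa [← ord.toSyn.injective h, hdeg]
  -- Now `p - q` has the head of `w g_j` but a signature below `σ`, so induction produces a
  -- forbidden collision.
  · exfalso
    have := below _ (fun h0 => sub_ne_zero_of_lt h (by rw [← neg_sub, h0, neg_zero])) hlow
    rw [← MonomialOrder.degree_neg, neg_sub, degree_sub_of_lt h, hdeg] at this
    rcases this with ⟨l, hl, hle⟩ | ⟨τ, hτ, h⟩
    · exact hno _ _ hadm l hl hle
    · exact hno' _ _ _ hadm h hτ

end Algebra

/-! ### Lists indexed from 1 and the search for the last matching rule. -/

section Lists

variable {α : Type*} (l : List α) (x d : α)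

theorem entry_append_of_le {j : ℕ} (hj : j ≤ l.length) : entry (l ++ [x]) d j = entry l d j := by
  cases j with
  | zero => rfl
  | succ j => exact List.getD_append _ _ _ _ hj

theorem entry_append_length_succ : entry (l ++ [x]) d (l.length + 1) = x := by
  simp [entry]

theorem entry_set_of_ne {j k : ℕ} (hk : 1 ≤ k) (hjk : j ≠ k) :
    entry (l.set (k - 1) x) d j = entry l d j := by
  cases j with
  | zero => rfl
  | succ j =>
    have : k - 1 ≠ j := by omega
    simp [entry, this]

theorem entry_set_self {k : ℕ} (hk : 1 ≤ k) (hkl : k ≤ l.length) :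
    entry (l.set (k - 1) x) d k = x := by
  cases k with
  | zero => omega
  | succ k =>
    have : k < l.length := hkl
    simp [entry, this]

theorem entry_modify_of_ne (φ : α → α) {j k : ℕ} (hk : 1 ≤ k) (hjk : j ≠ k) :
    entry (l.modify (k - 1) φ) d j = entry l d j := by
  cases j with
  | zero => rfl
  | succ j =>
    have : k - 1 ≠ j := by omega
    simp [entry, this]

theorem entry_modify_self (φ : α → α) {k : ℕ} (hk : 1 ≤ k) (hkl : k ≤ l.length) :
    entry (l.modify (k - 1) φ) d k = φ (entry l d k) := by
  cases k with
  | zero => omega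
  | succ k =>
    have : k < l.length := hkl
    simp [entry, this]

theorem entry_mapIdx {β : Type*} (φ : ℕ → α → β) (e : β) {j : ℕ} (hj : j < l.length) :
    entry (l.mapIdx φ) e (j + 1) = φ j l[j] := by
  simp [entry, hj]

/-- The rules of the current index are `(φ j, j)` in order of creation. An index `k > N` matches its
own rule (`hPk`), so the last match is `k` unless a later one exists. The input `N` has no rule, and
for it the search may find nothing. -/
theorem find_last_range' {β : Type*} (φ : ℕ → β) (P : β → Prop) [DecidablePred P] (N k m : ℕ)
    (hk : k ≤ N + m) (hPk : N < k → P (φ k)) (hNk : N ≤ k) :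
    (∀ ρ, (((List.range' (N + 1) m).map fun j => (φ j, j)).reverse.find?
      (fun ρ => decide (P ρ.1))) = some ρ → ρ.2 = k) ↔ ∀ j, k < j → j ≤ N + m → ¬ P (φ j) := by
  induction m with
  | zero => exact ⟨fun _ j h h' => by omega, fun _ ρ h => by simp at h⟩
  | succ m ih =>
    rw [List.range'_concat, List.map_append, List.reverse_append]
    simp only [one_mul, List.map_cons, List.map_nil, List.reverse_cons, List.reverse_nil,
      List.nil_append, List.singleton_append, List.find?_cons]
    have hidx : N + 1 + m = N + (m + 1) := by ring
    rw [hidx]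
    by_cases hP : P (φ (N + (m + 1)))
    · simp only [hP, decide_true, Option.some.injEq, forall_eq']
      refine ⟨fun h j h1 h2 => by omega, fun h => ?_⟩
      by_contra hne
      exact h _ (by omega) le_rfl hP
    · simp only [hP, decide_false]
      have hk' : k ≤ N + m := by
        rcases hk.lt_or_eq with h | h
        · omega
        · exact absurd (h ▸ hPk (by omega)) hP
      rw [ih hk']
      refine ⟨fun h j h1 h2 => ?_, fun h j h1 h2 => h j h1 (by omega)⟩
      rcases h2.lt_or_eq with h2 | rfl
      · exact h j h1 (by omega)
      · exact hP

end Lists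

/-! ### The invariant of one call of Partial_Basis. -/

section States

variable {n : ℕ} {K : Type*} [Field K]

namespace State

variable (st : State n K)

/-- Append a labeled polynomial and the corresponding rule. -/
def appendRule (st : State n K) (s : Sig n) (p : MvPolynomial (Fin n) K) : State n K :=
  (st.append s p).addRule s (st.size + 1)

variable {st} {s : Sig n} {p : MvPolynomial (Fin n) K} {j k : ℕ}

@[simp] theorem size_appendRule : (st.appendRule s p).size = st.size + 1 := by
  simp [appendRule, size, append, addRule]

theorem sig_appendRule_of_le (hj : j ≤ st.size) : (st.appendRule s p).sig j = st.sig j :=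
  congrArg Prod.fst (entry_append_of_le st.lp (s, p) (0, 0) hj)

theorem poly_appendRule_of_le (hj : j ≤ st.size) : (st.appendRule s p).poly j = st.poly j :=
  congrArg Prod.snd (entry_append_of_le st.lp (s, p) (0, 0) hj)

@[simp] theorem sig_appendRule_last : (st.appendRule s p).sig (st.size + 1) = s :=
  congrArg Prod.fst (entry_append_length_succ st.lp (s, p) (0, 0))

@[simp] theorem poly_appendRule_last : (st.appendRule s p).poly (st.size + 1) = p :=
  congrArg Prod.snd (entry_append_length_succ st.lp (s, p) (0, 0))

@[simp] theorem size_setPoly : (st.setPoly k p).size = st.size := by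
  simp [setPoly, size]

@[simp] theorem rules_setPoly : (st.setPoly k p).rules = st.rules := rfl

theorem poly_setPoly_of_ne (hk : 1 ≤ k) (hjk : j ≠ k) : (st.setPoly k p).poly j = st.poly j :=
  congrArg Prod.snd (entry_set_of_ne st.lp (st.sig k, p) (0, 0) hk hjk)

theorem poly_setPoly_self (hk : 1 ≤ k) (hks : k ≤ st.size) : (st.setPoly k p).poly k = p :=
  congrArg Prod.snd (entry_set_self st.lp (st.sig k, p) (0, 0) hk hks)

theorem sig_setPoly (hk : 1 ≤ k) (hks : k ≤ st.size) : (st.setPoly k p).sig j = st.sig j := by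
  by_cases hjk : j = k
  · subst hjk
    have := entry_set_self st.lp (st.sig j, p) (0, 0) hk hks
    exact (congrArg Prod.fst this : _ = (st.sig j, p).1)
  · exact congrArg Prod.fst (entry_set_of_ne st.lp (st.sig k, p) (0, 0) hk hjk)

open Classical in
theorem rewritable_iff {u : Mon n} : st.Rewritable u k ↔
    ¬ ∀ ρ, (entry st.rules [] (st.sig k).2).reverse.find?
      (fun ρ => decide (ρ.1 ≤ u + (st.sig k).1)) = some ρ → ρ.2 = k := by
  unfold Rewritable findRewriting
  cases (entry st.rules [] (st.sig k).2).reverse.find?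
    (fun ρ => decide (ρ.1 ≤ u + (st.sig k).1)) <;> simp

end State

/-- What is fixed during a call of `Partial_Basis` on the input `f` with index `N`, when the
polynomials with indices in `prev` are a Gröbner basis of `J`. -/
structure CallData (ord : MonomialOrder (Fin n)) (J : Ideal (MvPolynomial (Fin n) K))
    (f : MvPolynomial (Fin n) K) (N : ℕ) (prev : Finset ℕ) (st₀ : State n K) : Prop where
  one_le : 1 ≤ N
  size : st₀.size = N
  length_rules : st₀.rules.length = N
  sig_input : st₀.sig N = (0, N)
  poly_input : st₀.poly N = f
  input_ne : f ≠ 0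
  rules_input : entry st₀.rules [] N = []
  pos : ∀ l ∈ prev, 1 ≤ l
  lt : ∀ l ∈ prev, l < N
  sig_prev : ∀ l ∈ prev, st₀.sig l = (0, l)
  mem : ∀ l ∈ prev, st₀.poly l ∈ J
  ne : ∀ l ∈ prev, st₀.poly l ≠ 0
  head : ∀ b ∈ J, b ≠ 0 → ∃ l ∈ prev, ord.degree (st₀.poly l) ≤ ord.degree b
  rules_prev : ∀ l ∈ prev, ∀ ρ ∈ entry st₀.rules [] l, ∃ l' ∈ prev, l' < l ∧
    ∀ v, ρ.1 ≤ v → ord.degree (st₀.poly l') ≤ v + ord.degree (st₀.poly l)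

/-- The invariant of `Partial_Basis`: `cur` contains the current basis and the completed
polynomials, `todo` the polynomials that wait for their reduction. -/
structure Inv (ord : MonomialOrder (Fin n)) (J : Ideal (MvPolynomial (Fin n) K))
    (f : MvPolynomial (Fin n) K) (N : ℕ) (prev : Finset ℕ) (st₀ st : State n K)
    (cur todo : Finset ℕ) : Prop where
  le_size : N ≤ st.size
  length_rules : st.rules.length = N
  low_sig : ∀ j ≤ N, st.sig j = st₀.sig j
  low_poly : ∀ j ≤ N, st.poly j = st₀.poly j
  low_rules : ∀ l < N, entry st.rules [] l = entry st₀.rules [] l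
  top_rules : entry st.rules [] N =
    (List.range' (N + 1) (st.size - N)).map fun j => ((st.sig j).1, j)
  sig_snd : ∀ j, N ≤ j → j ≤ st.size → (st.sig j).2 = N
  hasSig : ∀ j, N ≤ j → j ≤ st.size → HasSig ord J f (st.sig j).1 (st.poly j)
  cur_le : ∀ j ∈ cur, j ≤ st.size
  cur_ne : ∀ j ∈ cur, st.poly j ≠ 0
  cur_cases : ∀ j ∈ cur, j ∈ prev ∨ N ≤ j
  prev_subset : prev ⊆ cur
  input_mem : N ∈ cur
  lt_todo : ∀ j ∈ todo, N < j
  todo_le : ∀ j ∈ todo, j ≤ st.size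
  todo_disj : ∀ j ∈ todo, j ∉ cur
  cover : ∀ j, N < j → j ≤ st.size → st.poly j ≠ 0 → j ∈ cur ∨ j ∈ todo

/-- `st'` extends `st`, and the polynomials with indices in `cur` are the same. -/
structure Extends (st st' : State n K) (cur : Finset ℕ) : Prop where
  size_le : st.size ≤ st'.size
  sig_eq : ∀ j ≤ st.size, st'.sig j = st.sig j
  poly_eq : ∀ j ∈ cur, st'.poly j = st.poly j

variable {ord : MonomialOrder (Fin n)} {J : Ideal (MvPolynomial (Fin n) K)}
  {f p : MvPolynomial (Fin n) K} {N : ℕ} {prev cur cur' todo : Finset ℕ}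
  {st₀ st st' st'' : State n K} {j k : ℕ} {u v : Mon n}

theorem Extends.refl : Extends st st cur := ⟨le_rfl, fun _ _ => rfl, fun _ _ => rfl⟩

theorem Extends.trans (h : Extends st st' cur) (h' : Extends st' st'' cur) :
    Extends st st'' cur where
  size_le := h.size_le.trans h'.size_le
  sig_eq j hj := (h'.sig_eq j (hj.trans h.size_le)).trans (h.sig_eq j hj)
  poly_eq j hj := (h'.poly_eq j hj).trans (h.poly_eq j hj)

theorem Extends.mono (h : Extends st st' cur) (hc : cur' ⊆ cur) : Extends st st' cur' :=
  ⟨h.size_le, h.sig_eq, fun j hj => h.poly_eq j (hc hj)⟩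

namespace Inv

/-- For current elements the state of the rules reduces to the recorded signatures: rejection means
that some later signature divides the given one. -/
theorem rewritable_iff (h : Inv ord J f N prev st₀ st cur todo) (hNk : N ≤ k)
    (hk : k ≤ st.size) :
    st.Rewritable u k ↔ ∃ j, k < j ∧ j ≤ st.size ∧ (st.sig j).1 ≤ u + (st.sig k).1 := by
  rw [State.rewritable_iff, h.sig_snd k hNk hk, h.top_rules]
  refine (not_congr (find_last_range' (fun j => (st.sig j).1) (fun m => m ≤ u + (st.sig k).1) N k
    (st.size - N) (by omega) (fun _ => le_add_self) hNk)).trans ?_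
  rw [Nat.add_sub_cancel' h.le_size]
  push Not
  rfl

/-- The lists of rules of old indices are frozen, and for the current index later elements are only
added. -/
theorem rewritable_mono (D : CallData ord J f N prev st₀) (h : Inv ord J f N prev st₀ st cur todo)
    {todo' : Finset ℕ} (h' : Inv ord J f N prev st₀ st' cur' todo') (he : Extends st st' cur)
    (hk : k ∈ cur) (hr : st.Rewritable u k) : st'.Rewritable u k := by
  rcases h.cur_cases k hk with hp | hNk
  · have hkN := D.lt k hp
    unfold State.Rewritable State.findRewriting at hr ⊢
    rw [h.low_sig k hkN.le, D.sig_prev k hp, h.low_rules k hkN] at hr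
    rwa [h'.low_sig k hkN.le, D.sig_prev k hp, h'.low_rules k hkN]
  · have hks := h.cur_le k hk
    obtain ⟨j, hj, hjs, hle⟩ := (h.rewritable_iff hNk hks).1 hr
    rw [h'.rewritable_iff hNk (hks.trans he.size_le)]
    refine ⟨j, hj, hjs.trans he.size_le, ?_⟩
    rwa [he.sig_eq j hjs, he.sig_eq k hks]

/-- A phantom rule of `k` matches `u` only if the head of an earlier old element divides `u · lt
(poly k)`, which minimality of `k` excludes. -/
theorem not_rewritable_prev (D : CallData ord J f N prev st₀)
    (h : Inv ord J f N prev st₀ st cur todo) (hk : k ∈ prev)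
    (hmin : ∀ l ∈ prev, l < k → ¬ ord.degree (st.poly l) ≤ u + ord.degree (st.poly k)) :
    ¬ st.Rewritable u k := by
  have hkN := D.lt k hk
  rw [State.rewritable_iff, not_not, h.low_sig k hkN.le, D.sig_prev k hk, h.low_rules k hkN]
  intro ρ hρ
  exfalso
  obtain ⟨l, hl, hlk, hle⟩ := D.rules_prev k hk ρ (List.mem_reverse.1 (List.mem_of_find?_eq_some hρ))
  have := List.find?_some hρ
  refine hmin l hl hlk ?_
  rw [h.low_poly k hkN.le, h.low_poly l (D.lt l hl).le]
  exact hle u (by simpa using this)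

theorem topReducible_iff (h : Inv ord J f N prev st₀ st cur todo) {t : Mon n}
    (D : CallData ord J f N prev st₀) :
    st.TopReducible ord prev t ↔ st₀.TopReducible ord prev t := by
  unfold State.TopReducible
  refine exists_congr fun l => and_congr_right fun hl => ?_
  rw [h.low_poly l (D.lt l hl).le]

theorem init (D : CallData ord J f N prev st₀) :
    Inv ord J f N prev st₀ st₀ (prev ∪ {N}) ∅ where
  le_size := D.size.ge
  length_rules := D.length_rules
  low_sig _ _ := rfl
  low_poly _ _ := rfl
  low_rules _ _ := rfl
  top_rules := by simp [D.rules_input, D.size]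
  sig_snd j h1 h2 := by
    obtain rfl : j = N := by have := D.size; omega
    rw [D.sig_input]
  hasSig j h1 h2 := by
    obtain rfl : j = N := by have := D.size; omega
    rw [D.sig_input, D.poly_input]
    exact ⟨1, one_ne_zero, MonomialOrder.degree_one, by simp⟩
  cur_le j hj := by
    rw [D.size]
    rcases Finset.mem_union.1 hj with hj | hj
    · exact (D.lt j hj).le
    · exact (Finset.mem_singleton.1 hj).le
  cur_ne j hj := by
    rcases Finset.mem_union.1 hj with hj | hj
    · exact D.ne j hj
    · rw [Finset.mem_singleton.1 hj, D.poly_input]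
      exact D.input_ne
  cur_cases j hj := by
    rcases Finset.mem_union.1 hj with hj | hj
    · exact Or.inl hj
    · exact Or.inr (Finset.mem_singleton.1 hj).ge
  prev_subset := Finset.subset_union_left
  input_mem := by simp
  lt_todo := by simp
  todo_le := by simp
  todo_disj := by simp
  cover j h1 h2 := by have := D.size; omega

/-- A new labeled polynomial waits for its reduction, or is zero. -/
theorem appendRule (h : Inv ord J f N prev st₀ st cur todo) (hN : 1 ≤ N) {s : Sig n}
    (hs : s.2 = N) (hp : HasSig ord J f s.1 p) {new : Finset ℕ} (hnew : new ⊆ {st.size + 1})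
    (hp0 : p ≠ 0 → st.size + 1 ∈ new) :
    Inv ord J f N prev st₀ (st.appendRule s p) cur (todo ∪ new) ∧
      Extends st (st.appendRule s p) cur := by
  have hle := h.le_size
  have hsig : ∀ j ≤ st.size, (st.appendRule s p).sig j = st.sig j :=
    fun j hj => State.sig_appendRule_of_le hj
  have hpoly : ∀ j ≤ st.size, (st.appendRule s p).poly j = st.poly j :=
    fun j hj => State.poly_appendRule_of_le hj
  have hrules : (st.appendRule s p).rules =
      st.rules.modify (N - 1) (fun l => l ++ [(s.1, st.size + 1)]) := by
    rw [← hs]; rfl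
  refine ⟨?_, ⟨by simp, hsig, fun j hj => hpoly j (h.cur_le j hj)⟩⟩
  constructor
  · simp; omega
  · rw [hrules]; simpa using h.length_rules
  · intro j hj
    rw [hsig j (hj.trans hle), h.low_sig j hj]
  · intro j hj
    rw [hpoly j (hj.trans hle), h.low_poly j hj]
  · intro l hl
    rw [hrules, entry_modify_of_ne _ _ _ hN hl.ne, h.low_rules l hl]
  · rw [hrules, entry_modify_self _ _ _ hN h.length_rules.ge, h.top_rules]
    have : (st.appendRule s p).size - N = (st.size - N) + 1 := by simp; omega
    rw [this, List.range'_concat, List.map_append]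
    have hidx : N + 1 + 1 * (st.size - N) = st.size + 1 := by omega
    congr 1
    · refine List.map_congr_left fun j hj => ?_
      rw [List.mem_range'_1] at hj
      rw [hsig j (by omega)]
    · rw [hidx]
      simp
  · intro j h1 h2
    rw [State.size_appendRule] at h2
    rcases h2.lt_or_eq with h2 | rfl
    · rw [hsig j (by omega), h.sig_snd j h1 (by omega)]
    · rw [State.sig_appendRule_last, hs]
  · intro j h1 h2
    rw [State.size_appendRule] at h2
    rcases h2.lt_or_eq with h2 | rfl
    · rw [hsig j (by omega), hpoly j (by omega)]
      exact h.hasSig j h1 (by omega)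
    · rwa [State.sig_appendRule_last, State.poly_appendRule_last]
  · intro j hj
    have := h.cur_le j hj
    rw [State.size_appendRule]; omega
  · intro j hj
    rw [hpoly j (h.cur_le j hj)]
    exact h.cur_ne j hj
  · exact h.cur_cases
  · exact h.prev_subset
  · exact h.input_mem
  · intro j hj
    rcases Finset.mem_union.1 hj with hj | hj
    · exact h.lt_todo j hj
    · have := Finset.mem_singleton.1 (hnew hj); omega
  · intro j hj
    rw [State.size_appendRule]
    rcases Finset.mem_union.1 hj with hj | hj
    · have := h.todo_le j hj; omega
    · have := Finset.mem_singleton.1 (hnew hj); omega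
  · intro j hj
    rcases Finset.mem_union.1 hj with hj | hj
    · exact h.todo_disj j hj
    · have := Finset.mem_singleton.1 (hnew hj)
      intro hc
      have := h.cur_le j hc
      omega
  · intro j h1 h2 h3
    rw [State.size_appendRule] at h2
    rcases h2.lt_or_eq with h2 | rfl
    · rw [hpoly j (by omega)] at h3
      exact (h.cover j h1 (by omega) h3).imp id (Finset.mem_union_left _)
    · rw [State.poly_appendRule_last] at h3
      exact Or.inr (Finset.mem_union_right _ (hp0 h3))

/-- The polynomial with the index `k` is replaced; then it may be completed or, if it is zero,
dropped. -/
theorem setPoly (h : Inv ord J f N prev st₀ st cur todo) (hk : k ∈ todo)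
    (hp : HasSig ord J f (st.sig k).1 p) {new redo : Finset ℕ} (hnew : new ⊆ {k})
    (hredo : redo ⊆ {k}) (hdisj : Disjoint new redo) (hp0 : p ≠ 0 → k ∈ new ∪ redo)
    (hnew0 : k ∈ new → p ≠ 0) :
    Inv ord J f N prev st₀ (st.setPoly k p) (cur ∪ new) (todo.erase k ∪ redo) ∧
      Extends st (st.setPoly k p) cur := by
  have hle := h.le_size
  have hNk := h.lt_todo k hk
  have hks := h.todo_le k hk
  have hkc := h.todo_disj k hk
  have hk1 : 1 ≤ k := by omega
  have hsig : ∀ j, (st.setPoly k p).sig j = st.sig j := fun j => State.sig_setPoly hk1 hks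
  have hpoly : ∀ j ≠ k, (st.setPoly k p).poly j = st.poly j :=
    fun j hj => State.poly_setPoly_of_ne hk1 hj
  have hself : (st.setPoly k p).poly k = p := State.poly_setPoly_self hk1 hks
  refine ⟨?_, ⟨by simp, fun j _ => hsig j, fun j hj => hpoly j ?_⟩⟩
  swap
  · rintro rfl
    exact hkc hj
  constructor
  · simpa using hle
  · exact h.length_rules
  · intro j hj
    rw [hsig, h.low_sig j hj]
  · intro j hj
    rw [hpoly j (by omega), h.low_poly j hj]
  · exact h.low_rules
  · simp only [hsig, State.size_setPoly, State.rules_setPoly]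
    exact h.top_rules
  · intro j h1 h2
    rw [hsig, h.sig_snd j h1 (by simpa using h2)]
  · intro j h1 h2
    rw [hsig]
    by_cases hjk : j = k
    · subst hjk
      rwa [hself]
    · rw [hpoly j hjk]
      exact h.hasSig j h1 (by simpa using h2)
  · intro j hj
    rw [State.size_setPoly]
    rcases Finset.mem_union.1 hj with hj | hj
    · exact h.cur_le j hj
    · rwa [Finset.mem_singleton.1 (hnew hj)]
  · intro j hj
    rcases Finset.mem_union.1 hj with hj | hj
    · rw [hpoly j (by rintro rfl; exact hkc hj)]
      exact h.cur_ne j hj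
    · obtain rfl := Finset.mem_singleton.1 (hnew hj)
      rw [hself]
      exact hnew0 hj
  · intro j hj
    rcases Finset.mem_union.1 hj with hj | hj
    · exact h.cur_cases j hj
    · obtain rfl := Finset.mem_singleton.1 (hnew hj)
      exact Or.inr hNk.le
  · exact h.prev_subset.trans Finset.subset_union_left
  · exact Finset.mem_union_left _ h.input_mem
  · intro j hj
    rcases Finset.mem_union.1 hj with hj | hj
    · exact h.lt_todo j (Finset.mem_of_mem_erase hj)
    · rwa [Finset.mem_singleton.1 (hredo hj)]
  · intro j hj
    rw [State.size_setPoly]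
    rcases Finset.mem_union.1 hj with hj | hj
    · exact h.todo_le j (Finset.mem_of_mem_erase hj)
    · rwa [Finset.mem_singleton.1 (hredo hj)]
  · intro j hj hc
    rcases Finset.mem_union.1 hc with hc | hc
    · rcases Finset.mem_union.1 hj with hj | hj
      · exact h.todo_disj j (Finset.mem_of_mem_erase hj) hc
      · obtain rfl := Finset.mem_singleton.1 (hredo hj)
        exact hkc hc
    · rcases Finset.mem_union.1 hj with hj | hj
      · exact Finset.ne_of_mem_erase hj (Finset.mem_singleton.1 (hnew hc))
      · exact Finset.disjoint_left.1 hdisj hc hj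
  · intro j h1 h2 h3
    by_cases hjk : j = k
    · subst hjk
      rw [hself] at h3
      exact (Finset.mem_union.1 (hp0 h3)).imp (Finset.mem_union_right _) (Finset.mem_union_right _)
    · rw [hpoly j hjk] at h3
      exact (h.cover j h1 (by simpa using h2) h3).imp (Finset.mem_union_left _)
        fun hj => Finset.mem_union_left _ (Finset.mem_erase.2 ⟨hjk, hj⟩)

end Inv

end States

/-! ### The loop of Reduction. -/

section Loops

variable {n : ℕ} {K : Type*} [Field K]
variable {ord : MonomialOrder (Fin n)} {J : Ideal (MvPolynomial (Fin n) K)}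
  {B : Set (MvPolynomial (Fin n) K)}
  {f p q : MvPolynomial (Fin n) K} {N : ℕ} {prev cur cur' todo : Finset ℕ}
  {st₀ st st' st'' : State n K} {j k : ℕ} {u v : Mon n}

theorem reductionStep_mem {μ : Mon n} (hq : q ∈ J) (h : ReductionStep ord q p p')
    (hp : HasSig ord J f μ p) : HasSig ord J f μ p' := by
  obtain ⟨-, d, -, -, rfl⟩ := h
  exact hp.sub (SigBelow.of_mem (J.mul_mem_left _ hq))

theorem IsNormalForm.hasSig {μ : Mon n} {h : MvPolynomial (Fin n) K} (hB : ∀ q ∈ B, q ∈ J)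
    (hn : IsNormalForm ord B p h) (hp : HasSig ord J f μ p) : HasSig ord J f μ h := by
  obtain ⟨hn, -⟩ := hn
  induction hn with
  | refl => exact hp
  | tail _ hs ih =>
    obtain ⟨q, hq, hs⟩ := hs
    exact reductionStep_mem (hB q hq) hs ih

theorem IsNormalForm.not_le {h : MvPolynomial (Fin n) K} (hn : IsNormalForm ord B p h)
    (hh : h ≠ 0) (hq : q ∈ B) (hq0 : q ≠ 0) : ¬ ord.degree q ≤ ord.degree h :=
  fun hle => hn.2 ⟨_, q, hq, hq0, _, MonomialOrder.degree_mem_support hh, hle, rfl⟩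

/-- A top-reduction subtracts two polynomials of different signatures, and the result has the larger
one. `hnf` keeps old elements from being reductors. -/
theorem Inv.topReduction (D : CallData ord J f N prev st₀)
    (h : Inv ord J f N prev st₀ st cur todo) (hk : k ∈ todo)
    (hnf : st.poly k ≠ 0 → ∀ l ∈ prev, ¬ ord.degree (st.poly l) ≤ ord.degree (st.poly k))
    {new redo : Finset ℕ} (ht : TopReduction ord prev cur k st st' new redo) :
    Inv ord J f N prev st₀ st' (cur ∪ new) (todo.erase k ∪ redo) ∧ Extends st st' cur ∧
      new ⊆ {k} := by
  have hNk := h.lt_todo k hk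
  have hks := h.todo_le k hk
  have hkN := h.sig_snd k hNk.le hks
  have hsk := h.hasSig k hNk.le hks
  have reductor : ∀ j, st.poly k ≠ 0 → IsReductor ord st prev cur k j →
      (st.sig j).2 = N ∧ HasSig ord J f (topMul ord st k j + (st.sig j).1)
        (monomial (topMul ord st k j)
          (ord.leadingCoeff (st.poly k) * (ord.leadingCoeff (st.poly j))⁻¹) * st.poly j) := by
    rintro j hk0 ⟨hjc, hle, -⟩
    have hNj : N ≤ j := (h.cur_cases j hjc).resolve_left fun hj => hnf hk0 j hj hle
    have hj0 := h.cur_ne j hjc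
    refine ⟨h.sig_snd j hNj (h.cur_le j hjc),
      (h.hasSig j hNj (h.cur_le j hjc)).monomial_mul _ (mul_ne_zero ?_ (inv_ne_zero ?_))⟩
    · simpa using hk0
    · simpa using hj0
  cases ht with
  | zero h0 =>
    refine ⟨?_, Extends.refl, by simp⟩
    simp only [Finset.union_empty]
    exact { h with
      lt_todo := fun j hj => h.lt_todo j (Finset.mem_of_mem_erase hj)
      todo_le := fun j hj => h.todo_le j (Finset.mem_of_mem_erase hj)
      todo_disj := fun j hj => h.todo_disj j (Finset.mem_of_mem_erase hj)
      cover := fun j h1 h2 h3 => (h.cover j h1 h2 h3).imp id fun hj =>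
        Finset.mem_erase.2 ⟨by rintro rfl; exact h3 h0, hj⟩ }
  | irreducible h0 _ =>
    have := h.setPoly hk (p := makeMonic ord (st.poly k)) hsk.makeMonic (new := {k}) (redo := ∅)
      (by simp) (by simp) (by simp) (by simp) (by simpa [makeMonic_eq_zero] using h0)
    exact ⟨this.1, this.2, by simp⟩
  | preserving j h0 hr hlt =>
    obtain ⟨hjN, hsj⟩ := reductor j h0 hr
    have hlt' : ord.toSyn (topMul ord st k j + (st.sig j).1) < ord.toSyn (st.sig k).1 := by
      rcases hlt with hlt | ⟨-, hlt⟩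
      · simp [Sig.mul, hjN, hkN] at hlt
      · exact hlt
    have := h.setPoly hk (p := topReduce ord st k j) (hsk.sub (hsj.sigBelow hlt')).makeMonic
      (new := ∅) (redo := {k}) (by simp) (by simp) (by simp) (by simp) (by simp)
    exact ⟨this.1, this.2, by simp⟩
  | raising j h0 hr hlt =>
    obtain ⟨hjN, hsj⟩ := reductor j h0 hr
    have hlt' : ord.toSyn (st.sig k).1 < ord.toSyn (topMul ord st k j + (st.sig j).1) := by
      refine lt_of_le_of_ne (not_lt.1 fun hlt' => hlt (Or.inr ⟨hjN.trans hkN.symm, hlt'⟩)) ?_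
      -- Equal signatures are excluded by the test in `IsReductor`.
      intro he
      apply hr.2.2.1
      exact Prod.ext (ord.toSyn.injective he).symm (hjN.trans hkN.symm)
    have := h.appendRule D.one_le (s := (st.sig j).mul (topMul ord st k j)) (p := topReduce ord st k j)
      hjN (hsj.sub_left (hsk.sigBelow hlt')).makeMonic (new := {st.size + 1}) (by simp) (by simp)
    have hset : todo.erase k ∪ {k, st.size + 1} = todo ∪ {st.size + 1} := by
      ext i
      by_cases hik : i = k <;> simp [hik, hk]
    rw [hset, Finset.union_empty]
    exact ⟨this.1, this.2, by simp⟩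

/-- `B` and the old labeled polynomials are related only through their heads: in the first pass `B`
holds `f₁` and the list its monic multiple. -/
theorem Inv.reductionLoop (D : CallData ord J f N prev st₀) (hB : ∀ q ∈ B, q ∈ J)
    (hBhead : ∀ l ∈ prev, ∃ q ∈ B, q ≠ 0 ∧ ord.degree q = ord.degree (st₀.poly l))
    {completed out : Finset ℕ} (hl : ReductionLoop ord B prev cur st todo completed st' out)
    (h : Inv ord J f N prev st₀ st (cur ∪ completed) todo) (hd : Disjoint cur completed) :
    Inv ord J f N prev st₀ st' (cur ∪ out) ∅ ∧ Extends st st' (cur ∪ completed) ∧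
      Disjoint cur out := by
  induction hl with
  | done st completed => exact ⟨h, Extends.refl, hd⟩
  | step st st₁ st' todo completed newly redo out k g hk _ hnf ht _ ih =>
    have hNk := h.lt_todo k hk
    have hks := h.todo_le k hk
    have hg : HasSig ord J f (st.sig k).1 g := hnf.hasSig hB (h.hasSig k hNk.le hks)
    have hself : (st.setPoly k g).poly k = g := State.poly_setPoly_self (by omega) hks
    obtain ⟨h₁, e₁⟩ := h.setPoly hk hg (new := ∅) (redo := {k}) (by simp) (by simp) (by simp)
      (by simp) (by simp)
    have hset : todo.erase k ∪ {k} = todo := by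
      ext i
      by_cases hik : i = k <;> simp [hik, hk]
    rw [hset, Finset.union_empty] at h₁
    obtain ⟨h₂, e₂, hnew⟩ := h₁.topReduction D hk (by
      rw [hself]
      intro hg0 l hl
      obtain ⟨q, hq, hq0, hdeg⟩ := hBhead l hl
      rw [h₁.low_poly l (D.lt l hl).le, ← hdeg]
      exact hnf.not_le hg0 hq hq0) ht
    rw [Finset.union_assoc] at h₂
    obtain ⟨h₃, e₃, hd'⟩ := ih h₂ (by
      rw [Finset.disjoint_union_right]
      refine ⟨hd, ?_⟩
      rw [Finset.disjoint_right]
      intro i hi hic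
      obtain rfl := Finset.mem_singleton.1 (hnew hi)
      exact h.todo_disj i hk (Finset.mem_union_left _ hic))
    exact ⟨h₃, (e₁.trans e₂).trans (e₃.mono (by
      rw [← Finset.union_assoc]
      exact Finset.subset_union_left)), hd'⟩

/-! ### Critical pairs and the loop of Partial_Basis. -/

/-- `c` is a critical pair of the current basis whose first component has the larger signature. -/
structure CritPair.Valid (ord : MonomialOrder (Fin n)) (N : ℕ) (st : State n K) (cur : Finset ℕ)
    (c : CritPair n) : Prop where
  k_mem : c.k ∈ cur
  l_mem : c.l ∈ cur
  le_k : N ≤ c.k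
  ne : c.k ≠ c.l
  u_eq : c.u = ord.degree (st.poly c.k) ⊔ ord.degree (st.poly c.l) - ord.degree (st.poly c.k)
  v_eq : c.v = ord.degree (st.poly c.k) ⊔ ord.degree (st.poly c.l) - ord.degree (st.poly c.l)
  not_lt : ¬ SigLT ord ((st.sig c.k).mul c.u) ((st.sig c.l).mul c.v)

theorem CritPair.Valid.mono {c : CritPair n} (hc : c.Valid ord N st cur) (hcur : cur ⊆ cur') :
    c.Valid ord N st cur' :=
  { hc with k_mem := hcur hc.k_mem, l_mem := hcur hc.l_mem }

theorem CritPair.Valid.extends {c : CritPair n} (h : Inv ord J f N prev st₀ st cur todo)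
    (he : Extends st st' cur) : c.Valid ord N st' cur ↔ c.Valid ord N st cur := by
  have key : c.k ∈ cur → c.l ∈ cur → (c.Valid ord N st' cur ↔ c.Valid ord N st cur) := by
    intro hk hl
    have e₁ := he.sig_eq _ (h.cur_le _ hk)
    have e₂ := he.sig_eq _ (h.cur_le _ hl)
    have e₃ := he.poly_eq _ hk
    have e₄ := he.poly_eq _ hl
    constructor
    · rintro ⟨-, -, h1, h2, h3, h4, h5⟩
      rw [e₃, e₄] at h3 h4
      rw [e₁, e₂] at h5
      exact ⟨hk, hl, h1, h2, h3, h4, h5⟩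
    · rintro ⟨-, -, h1, h2, h3, h4, h5⟩
      rw [← e₃, ← e₄] at h3 h4
      rw [← e₁, ← e₂] at h5
      exact ⟨hk, hl, h1, h2, h3, h4, h5⟩
  exact ⟨fun hc => (key hc.k_mem hc.l_mem).1 hc, fun hc => (key hc.k_mem hc.l_mem).2 hc⟩

/-- The pair `c` is discarded by the rewrite criterion. -/
def CritPair.Rewritten (st : State n K) (c : CritPair n) : Prop :=
  st.Rewritable c.u c.k ∨ st.Rewritable c.v c.l

theorem CritPair.Rewritten.mono {c : CritPair n} (hc : c.Rewritten st)
    (D : CallData ord J f N prev st₀) (h : Inv ord J f N prev st₀ st cur todo) {todo' : Finset ℕ}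
    (h' : Inv ord J f N prev st₀ st' cur' todo') (he : Extends st st' cur)
    (hk : c.k ∈ cur) (hl : c.l ∈ cur) : c.Rewritten st' :=
  hc.imp (h.rewritable_mono D h' he hk) (h.rewritable_mono D h' he hl)

/-- The two components of a pair that is not rewritten have different signatures, so the larger one
cannot cancel. -/
theorem hasSig_sPolynomial (D : CallData ord J f N prev st₀)
    (h : Inv ord J f N prev st₀ st cur todo) {c : CritPair n} (hc : c.Valid ord N st cur)
    (hr : ¬ c.Rewritten st) :
    HasSig ord J f (c.u + (st.sig c.k).1)
      (ord.sPolynomial (st.poly c.k) (st.poly c.l)) := by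
  rw [MonomialOrder.sPolynomial_def, ← hc.u_eq, ← hc.v_eq]
  have hks := h.cur_le _ hc.k_mem
  have hls := h.cur_le _ hc.l_mem
  have hk0 : ord.leadingCoeff (st.poly c.k) ≠ 0 := by simpa using h.cur_ne _ hc.k_mem
  have hl0 : ord.leadingCoeff (st.poly c.l) ≠ 0 := by simpa using h.cur_ne _ hc.l_mem
  refine ((h.hasSig _ hc.le_k hks).monomial_mul c.u hl0).sub ?_
  rcases h.cur_cases _ hc.l_mem with hl | hl
  · apply SigBelow.of_mem
    rw [h.low_poly _ (D.lt _ hl).le]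
    exact J.mul_mem_left _ (D.mem _ hl)
  · refine ((h.hasSig _ hl hls).monomial_mul c.v hk0).sigBelow (lt_of_le_of_ne ?_ ?_)
    · refine not_lt.1 fun hlt => hc.not_lt (Or.inr ⟨?_, hlt⟩)
      simp [Sig.mul, h.sig_snd _ hl hls, h.sig_snd _ hc.le_k hks]
    · intro he
      have he := ord.toSyn.injective he
      rw [CritPair.Rewritten, h.rewritable_iff hc.le_k hks, h.rewritable_iff hl hls] at hr
      push Not at hr
      -- If the signatures agreed, the element created later would rewrite the other component.
      rcases lt_or_gt_of_ne hc.ne with hlt | hlt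
      · exact hr.1 _ hlt hls (he ▸ le_add_self)
      · exact hr.2 _ hlt hks (he ▸ le_add_self)

-- Once treated, every pair is rewritten, whether it was discarded or used, and whether or not its
-- S-polynomial is zero.
open Classical in
theorem Inv.foldl_spolStep (D : CallData ord J f N prev st₀) (L : List (CritPair n))
    (h : Inv ord J f N prev st₀ st cur todo) (hL : ∀ c ∈ L, c.Valid ord N st cur) :
    Inv ord J f N prev st₀ (L.foldl (spolStep ord) (st, todo)).1 cur
        (L.foldl (spolStep ord) (st, todo)).2 ∧
      Extends st (L.foldl (spolStep ord) (st, todo)).1 cur ∧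
      ∀ c ∈ L, c.Rewritten (L.foldl (spolStep ord) (st, todo)).1 := by
  induction L generalizing st todo with
  | nil => exact ⟨h, Extends.refl, by simp⟩
  | cons c L ih =>
    have hc := hL c (by simp)
    have step : ∃ st₁ todo₁, spolStep ord (st, todo) c = (st₁, todo₁) ∧
        Inv ord J f N prev st₀ st₁ cur todo₁ ∧ Extends st st₁ cur ∧ c.Rewritten st₁ := by
      by_cases hr : c.Rewritten st
      · refine ⟨st, todo, ?_, h, Extends.refl, hr⟩
        rw [spolStep, if_neg]
        rwa [CritPair.Rewritten, or_iff_not_and_not] at hr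
      · have hsig := hasSig_sPolynomial D h hc hr
        have hks := h.cur_le _ hc.k_mem
        set s := ord.sPolynomial (st.poly c.k) (st.poly c.l) with hs
        obtain ⟨h₁, e₁⟩ := h.appendRule D.one_le (s := (st.sig c.k).mul c.u) (p := s)
          (h.sig_snd _ hc.le_k hks) hsig (new := if s = 0 then ∅ else {st.size + 1})
          (by split_ifs <;> simp) (fun h0 => by simp [h0])
        refine ⟨_, _, ?_, h₁, e₁, Or.inl ?_⟩
        · rw [spolStep, if_pos (by rwa [CritPair.Rewritten, not_or] at hr)]
          have hsize : (st.append ((st.sig c.k).mul c.u) s).size = st.size + 1 := by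
            simp [State.append, State.size]
          simp only [← hs, hsize, State.appendRule]
          split_ifs <;> simp
        · rw [h₁.rewritable_iff hc.le_k (hks.trans e₁.size_le)]
          -- The S-polynomial just recorded has signature `u · sig k` and an index above `k`, so it
          -- rewrites `(u, k)`.
          refine ⟨st.size + 1, by omega, by simp, ?_⟩
          rw [State.sig_appendRule_last, e₁.sig_eq _ hks]
          exact le_rfl
    obtain ⟨st₁, todo₁, heq, h₁, e₁, hr₁⟩ := step
    rw [List.foldl_cons, heq]
    obtain ⟨h₂, e₂, hr₂⟩ := ih h₁ fun c' hc' =>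
      (CritPair.Valid.extends h e₁).2 (hL c' (List.mem_cons_of_mem _ hc'))
    refine ⟨h₂, e₁.trans e₂, fun c' hc' => ?_⟩
    rcases List.mem_cons.1 hc' with rfl | hc'
    · exact hr₁.mono D h₁ h₂ e₂ hc.k_mem hc.l_mem
    · exact hr₂ c' hc'

/-- Every critical pair of the current basis that passes the top-reduction criterion is still
waiting or has been discarded by the rewrite criterion. -/
def Covers (ord : MonomialOrder (Fin n)) (N : ℕ) (prev : Finset ℕ) (st : State n K)
    (P : Set (CritPair n)) (cur : Finset ℕ) : Prop :=
  ∀ c : CritPair n, c.t = ord.degree (st.poly c.k) ⊔ ord.degree (st.poly c.l) →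
    c.Valid ord N st cur → SigLT ord ((st.sig c.l).mul c.v) ((st.sig c.k).mul c.u) →
    ¬ st.TopReducible ord prev (c.u + (st.sig c.k).1) →
    ¬ ((st.sig c.l).2 = N ∧ st.TopReducible ord prev (c.v + (st.sig c.l).1)) →
    c ∈ P ∨ c.Rewritten st

theorem SigLT.asymm {s t : Sig n} (h : SigLT ord s t) : ¬ SigLT ord t s := by
  rintro (h' | ⟨h1', h2'⟩) <;> rcases h with h | ⟨h1, h2⟩
  · omega
  · omega
  · omega
  · exact h2.asymm h2'

/-- Strictness of the comparison makes the stored pair independent of the order in which its two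
indices are presented. -/
theorem mem_critPair_of_lt {c : CritPair n} (hc : c.Valid ord N st cur)
    (ht : c.t = ord.degree (st.poly c.k) ⊔ ord.degree (st.poly c.l))
    (hlt : SigLT ord ((st.sig c.l).mul c.v) ((st.sig c.k).mul c.u))
    (hk : ¬ st.TopReducible ord prev (c.u + (st.sig c.k).1))
    (hl : ¬ ((st.sig c.l).2 = N ∧ st.TopReducible ord prev (c.v + (st.sig c.l).1))) :
    c ∈ critPair ord st c.k c.l N prev ∧ c ∈ critPair ord st c.l c.k N prev := by
  obtain ⟨t, k, u, l, v⟩ := c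
  have hu := hc.u_eq
  have hv := hc.v_eq
  clear hc
  dsimp only at *
  subst hu hv ht
  constructor
  · simp only [critPair]
    rw [if_neg fun h => hk h.2, if_neg hl, if_neg hlt.asymm]
    exact Set.mem_singleton _
  · simp only [critPair]
    rw [sup_comm (ord.degree (st.poly l)) (ord.degree (st.poly k))]
    rw [if_neg hl, if_neg fun h => hk h.2, if_pos hlt]
    exact Set.mem_singleton _

theorem Inv.valid_of_mem_critPair (h : Inv ord J f N prev st₀ st cur' todo)
    (D : CallData ord J f N prev st₀) {l : ℕ} (hk : k ∈ cur) (hl : l ∈ cur) (hcur : cur ⊆ cur')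
    (hNk : N ≤ k) (hkl : k ≠ l) {c : CritPair n} (hc : c ∈ critPair ord st k l N prev) :
    c.Valid ord N st cur := by
  simp only [critPair] at hc
  split_ifs at hc with h1 h2 h3
  · exact absurd hc (Set.notMem_empty _)
  · exact absurd hc (Set.notMem_empty _)
  · obtain rfl := hc
    -- A swap puts `l` first because its signature is larger; old elements have smaller index, hence
    -- smaller signature.
    have hNl : N ≤ l := by
      refine (h.cur_cases l (hcur hl)).resolve_left fun hp => ?_
      have h2 : (st.sig l).2 = l := by
        rw [h.low_sig l (D.lt l hp).le, D.sig_prev l hp]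
      have h3' := h.sig_snd k hNk (h.cur_le k (hcur hk))
      have := D.lt l hp
      rcases h3 with h3 | ⟨h3, -⟩ <;> simp only [Sig.mul, h2, h3'] at h3 <;> omega
    refine ⟨hl, hk, hNl, hkl.symm, ?_, ?_, h3.asymm⟩ <;> simp [sup_comm]
  · obtain rfl := hc
    exact ⟨hk, hl, hNk, hkl, rfl, rfl, h3⟩

theorem Inv.foldl_addIndex (D : CallData ord J f N prev st₀)
    (h : Inv ord J f N prev st₀ st cur' todo) (L : List ℕ) (hL : L.Nodup)
    (P : Set (CritPair n)) (hNL : ∀ k ∈ L, N ≤ k ∧ k ∉ cur)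
    (hcur : cur ∪ L.toFinset ⊆ cur') (hval : ∀ c ∈ P, c.Valid ord N st cur)
    (hcov : Covers ord N prev st P cur) :
    (L.foldl (addIndex ord st N prev) (P, cur)).2 = cur ∪ L.toFinset ∧
      (∀ c ∈ (L.foldl (addIndex ord st N prev) (P, cur)).1, c.Valid ord N st (cur ∪ L.toFinset)) ∧
      Covers ord N prev st (L.foldl (addIndex ord st N prev) (P, cur)).1 (cur ∪ L.toFinset) := by
  induction L generalizing P cur with
  | nil => simpa using ⟨hval, hcov⟩
  | cons k L ih =>
    have hset : cur ∪ (k :: L).toFinset = (cur ∪ {k}) ∪ L.toFinset := by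
      ext i; simp
    rw [hset] at hcur ⊢
    obtain ⟨hNk, hkc⟩ := hNL k (by simp)
    rw [List.nodup_cons] at hL
    rw [List.foldl_cons, addIndex]
    have hcur' : cur ∪ {k} ⊆ cur' := Finset.subset_union_left.trans hcur
    refine ih hL.2 _ (fun i hi => ⟨(hNL i (List.mem_cons_of_mem _ hi)).1, ?_⟩) hcur ?_ ?_
    · have := (hNL i (List.mem_cons_of_mem _ hi)).2
      have hik : i ≠ k := by rintro rfl; exact hL.1 hi
      simp [this, hik]
    · rintro c (hc | hc)
      · exact (hval c hc).mono Finset.subset_union_left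
      · obtain ⟨j, hj, hc⟩ := Set.mem_iUnion₂.1 hc
        exact h.valid_of_mem_critPair D (by simp) (Finset.mem_union_left _ hj) hcur' hNk
          (by rintro rfl; exact hkc hj) hc
    · intro c ht hc hlt hk hl
      have hmem := mem_critPair_of_lt hc ht hlt hk hl
      by_cases hck : c.k = k
      · have hcl : c.l ∈ cur := by
          have := hc.l_mem
          have hne := hc.ne
          rw [hck] at hne
          simpa [hne.symm] using this
        left; right
        exact Set.mem_iUnion₂.2 ⟨c.l, hcl, hck ▸ hmem.1⟩
      · have hck' : c.k ∈ cur := by simpa [hck] using hc.k_mem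
        by_cases hcl : c.l = k
        · left; right
          exact Set.mem_iUnion₂.2 ⟨c.k, hck', hcl ▸ hmem.2⟩
        · have hcl' : c.l ∈ cur := by simpa [hcl] using hc.l_mem
          exact (hcov c ht ⟨hck', hcl', hc.le_k, hc.ne, hc.u_eq, hc.v_eq, hc.not_lt⟩ hlt hk hl).imp
            Or.inl id

theorem Covers.extends {P P' : Set (CritPair n)} (D : CallData ord J f N prev st₀)
    (h : Inv ord J f N prev st₀ st cur todo) {todo' : Finset ℕ}
    (h' : Inv ord J f N prev st₀ st' cur' todo') (he : Extends st st' cur)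
    (hcov : Covers ord N prev st P cur) (hP : ∀ c ∈ P, c ∈ P' ∨ c.Rewritten st') :
    Covers ord N prev st' P' cur := by
  intro c ht hc hlt hk hl
  have hks := he.sig_eq _ (h.cur_le _ hc.k_mem)
  have hls := he.sig_eq _ (h.cur_le _ hc.l_mem)
  rw [he.poly_eq _ hc.k_mem, he.poly_eq _ hc.l_mem] at ht
  rw [hks, hls] at hlt
  rw [hks, h'.topReducible_iff D, ← h.topReducible_iff D] at hk
  rw [hls, h'.topReducible_iff D, ← h.topReducible_iff D] at hl
  rcases hcov c ht ((CritPair.Valid.extends h he).1 hc) hlt hk hl with hc' | hr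
  · exact hP c hc'
  · exact Or.inr (hr.mono D h h' he hc.k_mem hc.l_mem)

/-- A pair leaves `P` only by being treated, hence rewritten, and it stays rewritten. On exit `P` is
empty, so every pair that passes the top-reduction test is rewritten. -/
theorem Inv.partialBasisLoop (D : CallData ord J f N prev st₀) (hB : ∀ q ∈ B, q ∈ J)
    (hBhead : ∀ l ∈ prev, ∃ q ∈ B, q ≠ 0 ∧ ord.degree q = ord.degree (st₀.poly l))
    {P : Set (CritPair n)} {out : Finset ℕ} (hl : PartialBasisLoop ord N B prev st P cur st' out)
    (h : Inv ord J f N prev st₀ st cur ∅) (hval : ∀ c ∈ P, c.Valid ord N st cur)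
    (hcov : Covers ord N prev st P cur) :
    Inv ord J f N prev st₀ st' out ∅ ∧ Covers ord N prev st' ∅ out := by
  induction hl with
  | done st cur => exact ⟨h, hcov⟩
  | step st st₁ st₂ st' P cur S R out d L _ hS hR hLn hLR _ ih =>
    obtain ⟨M, -, hM, -, hfold⟩ := hS
    have hstep := h.foldl_spolStep D M fun c hc => hval c ((hM c).1 hc).1
    rw [hfold] at hstep
    obtain ⟨h₁, e₁, hr₁⟩ := hstep
    obtain ⟨h₂, e₂, hd⟩ := Inv.reductionLoop D hB hBhead hR
      (by simpa using h₁) (Finset.disjoint_empty_right _)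
    rw [Finset.union_empty] at e₂
    have e := e₁.trans e₂
    have hadd := h₂.foldl_addIndex (cur := cur) D L hLn (P \ {c ∈ P | c.t.degree = d}) (by
      intro k hk
      have hkR : k ∈ R := hLR ▸ List.mem_toFinset.2 hk
      have hkc : k ∉ cur := Finset.disjoint_right.1 hd hkR
      refine ⟨?_, hkc⟩
      exact (h₂.cur_cases k (Finset.mem_union_right _ hkR)).resolve_left
        fun hp => hkc (h.prev_subset hp)) (by rw [hLR])
      (fun c hc => (CritPair.Valid.extends h e).2 (hval c hc.1))
      (hcov.extends D h h₂ e fun c hc => by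
        by_cases hdeg : c.t.degree = d
        · right
          have hc' := hval c hc
          exact (hr₁ c ((hM c).2 ⟨hc, hdeg⟩)).mono D h₁ h₂ e₂ hc'.k_mem hc'.l_mem
        · exact Or.inl ⟨hc, fun hc' => hdeg hc'.2⟩)
    rw [hLR] at hadd
    obtain ⟨hcur, hval₂, hcov₂⟩ := hadd
    rw [hcur] at ih
    exact ih h₂ hval₂ hcov₂

theorem Inv.partialBasis_init (D : CallData ord J f N prev st₀) :
    (∀ c ∈ ⋃ j ∈ prev, critPair ord st₀ N j N prev, c.Valid ord N st₀ (prev ∪ {N})) ∧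
      Covers ord N prev st₀ (⋃ j ∈ prev, critPair ord st₀ N j N prev) (prev ∪ {N}) := by
  refine ⟨fun c hc => ?_, fun c ht hc hlt hk hl => Or.inl ?_⟩
  · obtain ⟨j, hj, hc⟩ := Set.mem_iUnion₂.1 hc
    exact (Inv.init D).valid_of_mem_critPair D (by simp) (by simp [hj]) le_rfl le_rfl
      (D.lt j hj).ne' hc
  · have hck : c.k = N := by
      rcases Finset.mem_union.1 hc.k_mem with hk | hk
      · exact absurd (D.lt _ hk) (not_lt.2 hc.le_k)
      · exact Finset.mem_singleton.1 hk
    have hcl : c.l ∈ prev := by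
      have := hc.l_mem
      have hne := hc.ne
      rw [hck] at hne
      simpa [hne.symm] using this
    exact Set.mem_iUnion₂.2 ⟨c.l, hcl, hck ▸ (mem_critPair_of_lt hc ht hlt hk hl).1⟩

/-! ### Divisibility of heads at the end of a call. -/

theorem Inv.exists_of_rewritable (h : Inv ord J f N prev st₀ st cur todo) {a : ℕ} {w : Mon n}
    (hNa : N ≤ a) (ha : a ≤ st.size) (huw : u ≤ w) (hr : st.Rewritable u a) :
    ∃ i, a < i ∧ i ≤ st.size ∧ (st.sig i).1 ≤ w + (st.sig a).1 := by
  obtain ⟨i, h1, h2, h3⟩ := (h.rewritable_iff hNa ha).1 hr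
  exact ⟨i, h1, h2, h3.trans (add_le_add_left huw _)⟩

theorem Inv.head_divisible (D : CallData ord J f N prev st₀)
    (h : Inv ord J f N prev st₀ st cur ∅) (hcov : Covers ord N prev st ∅ cur)
    (hp : p ∈ J ⊔ Ideal.span {f}) (hp0 : p ≠ 0) :
    ∃ k ∈ cur, ord.degree (st.poly k) ≤ ord.degree p := by
  have hpoly : ∀ l ∈ prev, st.poly l = st₀.poly l := fun l hl => h.low_poly l (D.lt l hl).le
  have hprev : ∀ l ∈ prev, st.poly l ∈ J ∧ st.poly l ≠ 0 := fun l hl => by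
    rw [hpoly l hl]
    exact ⟨D.mem l hl, D.ne l hl⟩
  have hJ : ∀ b ∈ J, b ≠ 0 → ∃ l ∈ prev, ord.degree (st.poly l) ≤ ord.degree b := by
    intro b hb hb0
    obtain ⟨l, hl, hle⟩ := D.head b hb hb0
    exact ⟨l, hl, by rwa [hpoly l hl]⟩
  have mem_cur : ∀ k, N ≤ k → k ≤ st.size → st.poly k ≠ 0 → k ∈ cur := by
    intro k h1 h2 h3
    rcases h1.lt_or_eq with h1 | rfl
    · exact (h.cover k h1 h2 h3).resolve_right (Finset.notMem_empty _)
    · exact h.input_mem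
  -- no pair of multiples with the same head monomial passes both criteria
  have nopair : ∀ k l w v, N ≤ k → k ∈ cur → l ∈ cur → k ≠ l →
      w + ord.degree (st.poly k) = v + ord.degree (st.poly l) →
      (∀ v' ≤ v, ¬ st.Rewritable v' l) →
      (∀ i, k < i → i ≤ st.size → ¬ (st.sig i).1 ≤ w + (st.sig k).1) →
      (∀ m ∈ prev, ¬ ord.degree (st.poly m) ≤ w + (st.sig k).1) →
      (∀ m ∈ prev, (st.sig l).2 = N → ¬ ord.degree (st.poly m) ≤ v + (st.sig l).1) →
      ((st.sig l).2 < N ∨ (st.sig l).2 = N ∧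
        ord.toSyn (v + (st.sig l).1) < ord.toSyn (w + (st.sig k).1)) → False := by
    intro k l w v hNk hk hl hkl heq hrl hrk htk htl hlt
    set t := ord.degree (st.poly k) ⊔ ord.degree (st.poly l) with ht
    have htw : t ≤ w + ord.degree (st.poly k) :=
      sup_le le_add_self (heq ▸ le_add_self)
    -- The common factor of the two multiples: removing it leaves the multipliers `u'` and `v'` of
    -- the critical pair.
    set m := w + ord.degree (st.poly k) - t with hm
    have hmt : m + t = w + ord.degree (st.poly k) := tsub_add_cancel_of_le htw
    have hu : t - ord.degree (st.poly k) + ord.degree (st.poly k) = t :=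
      tsub_add_cancel_of_le le_sup_left
    have hv : t - ord.degree (st.poly l) + ord.degree (st.poly l) = t :=
      tsub_add_cancel_of_le le_sup_right
    set u' := t - ord.degree (st.poly k)
    set v' := t - ord.degree (st.poly l)
    have hwu : w = m + u' := by
      apply add_right_cancel (b := ord.degree (st.poly k))
      rw [add_assoc, hu, hmt]
    have hvv : v = m + v' := by
      apply add_right_cancel (b := ord.degree (st.poly l))
      rw [add_assoc, hv, hmt, heq]
    have huw : u' ≤ w := hwu ▸ le_add_self
    have hvw : v' ≤ v := hvv ▸ le_add_self
    have hks := h.cur_le k hk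
    have hkN := h.sig_snd k hNk hks
    have hslt : SigLT ord ((st.sig l).mul v') ((st.sig k).mul u') := by
      rcases hlt with hlt | ⟨hlN, hlt⟩
      · exact Or.inl (by simpa [Sig.mul, hkN] using hlt)
      · refine Or.inr ⟨by simp [Sig.mul, hkN, hlN], ?_⟩
        rw [hwu, hvv, add_assoc, add_assoc, map_add, map_add ord.toSyn m] at hlt
        exact lt_of_add_lt_add_left hlt
    rcases hcov ⟨t, k, u', l, v'⟩ rfl ⟨hk, hl, hNk, hkl, rfl, rfl, hslt.asymm⟩ hslt
      (fun ⟨i, hi, hle⟩ => htk i hi (hle.trans (add_le_add_left huw _)))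
      (fun ⟨hN, i, hi, hle⟩ => htl i hi hN (hle.trans (add_le_add_left hvw _))) with h' | h' | h'
    · exact h'
    · obtain ⟨i, h1, h2, h3⟩ := h.exists_of_rewritable hNk hks huw h'
      exact hrk i h1 h2 h3
    · exact hrl _ hvw h'
  have key : ∀ σ, HasSig ord J f σ p → ∃ k ∈ cur, ord.degree (st.poly k) ≤ ord.degree p := by
    intro σ hσ
    refine (F5C.head_divisible (g := st.poly) (μ := fun k => (st.sig k).1) (prev := prev)
      h.le_size (by rw [h.low_sig N le_rfl, D.sig_input]) hJ hprev h.hasSig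
      ?_ ?_ σ p hp0 hσ).elim ?_ ?_
    · rintro τ t ⟨k, w, hNk, hks, hk0, rfl, rfl, hrk, htk⟩ l hl hle
      classical
      -- The least old index whose head divides is the one that no phantom rule rejects.
      let s := prev.filter fun l => ord.degree (st.poly l) ≤ w + ord.degree (st.poly k)
      have hs : s.Nonempty := ⟨l, by simp [s, hl, hle]⟩
      obtain ⟨hlp, hlle⟩ := Finset.mem_filter.1 (s.min'_mem hs)
      have hmin : ∀ i ∈ prev, i < s.min' hs →
          ¬ ord.degree (st.poly i) ≤ w + ord.degree (st.poly k) := fun i hi hlt hle =>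
        absurd (s.min'_le i (Finset.mem_filter.2 ⟨hi, hle⟩)) (not_le.2 hlt)
      generalize s.min' hs = l at hlp hlle hmin
      have hlN := D.lt l hlp
      have heq := tsub_add_cancel_of_le hlle
      have hsl : (st.sig l).2 = l := by rw [h.low_sig l hlN.le, D.sig_prev l hlp]
      refine nopair k l w _ hNk (mem_cur k hNk hks hk0) (h.prev_subset hlp) (by omega) heq.symm
        ?_ hrk htk (fun _ _ h => by omega) (Or.inl (by omega))
      intro v' hv'
      refine h.not_rewritable_prev D hlp fun i hi hil hle => hmin i hi hil (hle.trans ?_)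
      rw [← heq]
      exact add_le_add_left hv' _
    · rintro σ τ t ⟨k, w, hNk, hks, hk0, rfl, rfl, hrk, htk⟩
        ⟨l, v, hNl, hls, hl0, heq, rfl, hrl, htl⟩ hlt
      refine nopair k l w v hNk (mem_cur k hNk hks hk0) (mem_cur l hNl hls hl0) ?_ heq.symm ?_ hrk
        htk (fun i hi _ => htl i hi) (Or.inr ⟨h.sig_snd l hNl hls, hlt⟩)
      -- Two multiples of the same element with the same head have the same multiplier, hence the
      -- same signature.
      · rintro rfl
        rw [add_right_cancel heq] at hlt
        exact hlt.false
      · intro v' hv' hr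
        obtain ⟨i, h1, h2, h3⟩ := h.exists_of_rewritable hNl hls hv' hr
        exact hrl i h1 h2 h3
    · rintro ⟨l, hl, hle⟩
      exact ⟨l, h.prev_subset hl, hle⟩
    · rintro ⟨τ, -, k, v, hNk, hk, hk0, hdeg, -⟩
      exact ⟨k, mem_cur k hNk hk hk0, hdeg ▸ le_add_self⟩
  rcases mem_sup_cases (ord := ord) hp with hpJ | ⟨σ, hσ⟩
  · obtain ⟨l, hl, hle⟩ := hJ p hpJ hp0
    exact ⟨l, h.prev_subset hl, hle⟩
  · exact key σ hσ

theorem isGroebnerBasis_partialBasis (D : CallData ord J f N prev st₀)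
    (hspan : J = Ideal.span (st₀.polys prev)) (hB : ∀ q ∈ B, q ∈ J)
    (hBhead : ∀ l ∈ prev, ∃ q ∈ B, q ≠ 0 ∧ ord.degree q = ord.degree (st₀.poly l))
    {out : Finset ℕ} (hl : PartialBasisLoop ord N B prev st₀
      (⋃ j ∈ prev, critPair ord st₀ N j N prev) (prev ∪ {N}) st' out) :
    IsGroebnerBasis ord (st'.polys out) (J ⊔ Ideal.span {f}) ∧ 0 ∉ st'.polys out := by
  obtain ⟨hval, hcov⟩ := Inv.partialBasis_init D
  obtain ⟨h, hcov⟩ := Inv.partialBasisLoop D hB hBhead hl (Inv.init D) hval hcov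
  have hsub : st'.polys out ⊆ (J ⊔ Ideal.span {f} : Ideal _) := by
    rintro _ ⟨k, hk, rfl⟩
    rcases h.cur_cases k hk with hp | hN
    · rw [h.low_poly k (D.lt k hp).le]
      exact Ideal.mem_sup_left (D.mem k hp)
    · exact (h.hasSig k hN (h.cur_le k hk)).mem_sup
  refine ⟨⟨?_, hsub, le_antisymm (Ideal.span_le.2 hsub) (sup_le ?_ ?_), fun p hp hp0 => ?_⟩, ?_⟩
  · refine ((out : Set ℕ).toFinite.image st'.poly).subset ?_
    rintro _ ⟨k, hk, rfl⟩
    exact ⟨k, hk, rfl⟩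
  · rw [hspan]
    apply Ideal.span_mono
    rintro _ ⟨k, hk, rfl⟩
    exact ⟨k, h.prev_subset hk, (h.low_poly k (D.lt k hk).le).symm⟩
  · apply Ideal.span_mono
    rintro _ rfl
    exact ⟨N, h.input_mem, by rw [h.low_poly N le_rfl, D.poly_input]⟩
  · obtain ⟨k, hk, hle⟩ := h.head_divisible D hcov hp hp0
    exact ⟨_, ⟨k, hk, rfl⟩, h.cur_ne k hk, hle⟩
  · rintro ⟨k, hk, h0⟩
    exact h.cur_ne k hk h0.symm

end Loops

/-! ### Interreduction, the reset of the state and the main loop. -/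

section MainLoop

variable {n : ℕ} {K : Type*} [Field K]
variable {ord : MonomialOrder (Fin n)} {I : Ideal (MvPolynomial (Fin n) K)}
  {P P' : Set (MvPolynomial (Fin n) K)} {f : MvPolynomial (Fin n) K} {prev : Finset ℕ}
  {st : State n K}

/-- If the head of `q` divides that of `p`, then `q` takes over the role of `p`. Otherwise the
cancelled term lies below the head of `p`, and `p'` has the same head. -/
theorem IsGroebnerBasis.interreductionStep (h : IsGroebnerBasis ord P I) (h0 : 0 ∉ P)
    (hs : InterreductionStep ord P P') : IsGroebnerBasis ord P' I ∧ 0 ∉ P' := by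
  obtain ⟨hfin, hsub, hspan, hhead⟩ := h
  obtain ⟨p, hp, q, hq, hqp, p', ⟨hq0, d, hd, hqd, hp'⟩, rfl⟩ := hs
  have hsub' : ((P \ {p}) ∪ {p'}) \ {0} ⊆ (I : Set (MvPolynomial (Fin n) K)) := by
    rintro x ⟨hx | rfl, -⟩
    · exact hsub hx.1
    · rw [hp']
      exact I.sub_mem (hsub hp) (I.mul_mem_left _ (hsub hq))
  have hmem : ∀ x ∈ P, x ≠ p → x ∈ ((P \ {p}) ∪ {p'}) \ {0} := fun x hx hxp =>
    ⟨Or.inl ⟨hx, hxp⟩, by rintro rfl; exact h0 hx⟩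
  refine ⟨⟨((hfin.sdiff).union (Set.finite_singleton p')).sdiff, hsub',
    le_antisymm (Ideal.span_le.2 hsub') ?_, fun r hr hr0 => ?_⟩, fun h => h.2 rfl⟩
  · rw [← hspan, Ideal.span_le]
    intro x hx
    by_cases hxp : x = p
    · rw [hxp]
      have hp'mem : p' ∈ Ideal.span (((P \ {p}) ∪ {p'}) \ {0}) := by
        by_cases hp'0 : p' = 0
        · rw [hp'0]
          exact Ideal.zero_mem _
        · exact Ideal.subset_span ⟨Or.inr rfl, hp'0⟩
      have hadd := Ideal.add_mem _ hp'mem (Ideal.mul_mem_left _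
        (monomial (d - ord.degree q) (coeff d p / ord.leadingCoeff q))
        (Ideal.subset_span (hmem q hq hqp)))
      rwa [eq_sub_iff_add_eq.1 hp'] at hadd
    · exact Ideal.subset_span (hmem x hx hxp)
  · obtain ⟨g, hg, hg0, hle⟩ := hhead r hr hr0
    by_cases hgp : g = p
    · subst hgp
      by_cases hqg : ord.degree q ≤ ord.degree g
      · exact ⟨q, hmem q hq hqp, hq0, hqg.trans hle⟩
      · have hlt : ord.toSyn d < ord.toSyn (ord.degree g) := by
          refine lt_of_le_of_ne (MonomialOrder.le_degree hd) fun he => hqg ?_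
          rwa [← ord.toSyn.injective he]
        have hdeg : ord.degree (monomial (d - ord.degree q)
            (coeff d g / ord.leadingCoeff q) * q) = d := by
          rw [degree_monomial_mul (div_ne_zero (mem_support_iff.1 hd) (by simpa using hq0)) hq0,
            tsub_add_cancel_of_le hqd]
        rw [← hdeg] at hlt
        have hp'0 : p' ≠ 0 := hp' ▸ sub_ne_zero_of_lt hlt
        exact ⟨p', ⟨Or.inr rfl, hp'0⟩, hp'0, by rwa [hp', degree_sub_of_lt hlt]⟩
    · exact ⟨g, hmem g hg hgp, hg0, hle⟩

theorem IsGroebnerBasis.makeMonic (h : IsGroebnerBasis ord P I) :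
    IsGroebnerBasis ord (makeMonic ord '' P) I := by
  obtain ⟨hfin, hsub, hspan, hhead⟩ := h
  have hsub' : F5C.makeMonic ord '' P ⊆ (I : Set (MvPolynomial (Fin n) K)) := by
    rintro _ ⟨p, hp, rfl⟩
    exact makeMonic_mem (hsub hp)
  refine ⟨hfin.image _, hsub', le_antisymm (Ideal.span_le.2 hsub') ?_, fun r hr hr0 => ?_⟩
  · rw [← hspan, Ideal.span_le]
    intro p hp
    exact makeMonic_mem_iff.1 (Ideal.subset_span ⟨p, hp, rfl⟩)
  · obtain ⟨g, hg, hg0, hle⟩ := hhead r hr hr0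
    exact ⟨_, ⟨g, hg, rfl⟩, makeMonic_eq_zero.not.2 hg0, by rwa [degree_makeMonic]⟩

theorem IsGroebnerBasis.interreduction (h : IsGroebnerBasis ord P I) (h0 : 0 ∉ P)
    {B : List (MvPolynomial (Fin n) K)} (hB : IsInterreduction ord P B) :
    IsGroebnerBasis ord {b | b ∈ B} I ∧ 0 ∉ B := by
  obtain ⟨P', hsteps, -, -, hBP⟩ := hB
  have key : IsGroebnerBasis ord P' I ∧ 0 ∉ P' := by
    clear hBP
    induction hsteps with
    | refl => exact ⟨h, h0⟩
    | tail _ hs ih => exact ih.1.interreductionStep ih.2 hs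
  refine ⟨hBP ▸ key.1.makeMonic, fun hmem => ?_⟩
  have : (0 : MvPolynomial (Fin n) K) ∈ F5C.makeMonic ord '' P' := hBP ▸ hmem
  obtain ⟨p, hp, hp0⟩ := this
  exact key.2 (makeMonic_eq_zero.1 hp0 ▸ hp)

theorem isGroebnerBasis_singleton (hf : f ≠ 0) : IsGroebnerBasis ord {f} (Ideal.span {f}) := by
  refine ⟨Set.finite_singleton f, Ideal.subset_span, rfl, fun p hp hp0 => ⟨f, rfl, hf, ?_⟩⟩
  obtain ⟨a, rfl⟩ := Ideal.mem_span_singleton'.1 hp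
  rw [MonomialOrder.degree_mul (left_ne_zero_of_mul hp0) hf]
  exact le_add_self

theorem span_singleton_makeMonic : Ideal.span {makeMonic ord f} = Ideal.span {f} := by
  apply le_antisymm <;> rw [Ideal.span_singleton_le_iff_mem]
  · exact makeMonic_mem (Ideal.mem_span_singleton_self f)
  · exact makeMonic_mem_iff.1 (Ideal.mem_span_singleton_self _)

/-- The state records a Gröbner basis of `I` as `Setup_Reduced_Basis` leaves it. -/
structure Records (ord : MonomialOrder (Fin n)) (I : Ideal (MvPolynomial (Fin n) K))
    (st : State n K) (prev : Finset ℕ) : Prop where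
  prev_eq : prev = Finset.Icc 1 st.size
  length_rules : st.rules.length = st.size
  sig_eq : ∀ l ∈ prev, st.sig l = (0, l)
  rules_eq : ∀ l ∈ prev, ∀ ρ ∈ entry st.rules [] l, ∃ l' ∈ prev, l' < l ∧
    ∀ v, ρ.1 ≤ v → ord.degree (st.poly l') ≤ v + ord.degree (st.poly l)
  groebner : IsGroebnerBasis ord (st.polys prev) I
  ne_zero : ∀ l ∈ prev, st.poly l ≠ 0

theorem records_reducedState {B : List (MvPolynomial (Fin n) K)}
    (hB : IsGroebnerBasis ord {b | b ∈ B} I) (h0 : 0 ∉ B) :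
    Records ord I (reducedState ord B) (Finset.Icc 1 B.length) := by
  have hsize : (reducedState ord B).size = B.length := by simp [reducedState, State.size]
  have hlp : ∀ j (hj : j < B.length),
      entry (reducedState ord B).lp (0, 0) (j + 1) = ((0, j + 1), B[j]) :=
    fun j hj => entry_mapIdx B _ _ hj
  have hsig : ∀ j < B.length, (reducedState ord B).sig (j + 1) = (0, j + 1) :=
    fun j hj => congrArg Prod.fst (hlp j hj)
  have hpoly : ∀ j (hj : j < B.length), (reducedState ord B).poly (j + 1) = B[j] :=
    fun j hj => congrArg Prod.snd (hlp j hj)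
  have hrules : ∀ j (hj : j < B.length), entry (reducedState ord B).rules [] (j + 1) =
      (B.take j).map fun q => (headMul ord B[j] q, 0) :=
    fun j hj => entry_mapIdx B _ _ hj
  have hidx : ∀ l ∈ Finset.Icc 1 B.length, ∃ j, ∃ _ : j < B.length, l = j + 1 := by
    intro l hl
    rw [Finset.mem_Icc] at hl
    exact ⟨l - 1, by omega, by omega⟩
  refine ⟨by rw [hsize], by simp [reducedState, State.size], fun l hl => ?_, fun l hl ρ hρ => ?_,
    ?_, fun l hl => ?_⟩
  · obtain ⟨j, hj, rfl⟩ := hidx l hl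
    exact hsig j hj
  · obtain ⟨j, hj, rfl⟩ := hidx l hl
    rw [hrules j hj] at hρ
    obtain ⟨q, hq, rfl⟩ := List.mem_map.1 hρ
    obtain ⟨i, hi, rfl⟩ := List.mem_iff_getElem.1 hq
    rw [List.length_take] at hi
    refine ⟨i + 1, Finset.mem_Icc.2 (by omega), by omega, fun v hv => ?_⟩
    rw [hpoly i (by omega), hpoly j hj]
    rw [List.getElem_take] at hv
    -- A multiple of `lcm / lt B[j]`, times `lt B[j]`, is a multiple of the lcm and so of `lt B[i]`.
    have h1 : ord.degree B[i] ≤ ord.degree B[j] ⊔ ord.degree B[i] := le_sup_right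
    refine h1.trans ?_
    rw [← tsub_le_iff_right]
    exact hv
  · convert hB using 1
    ext p
    constructor
    · rintro ⟨k, hk, rfl⟩
      obtain ⟨j, hj, rfl⟩ := hidx k hk
      rw [hpoly j hj]
      exact List.getElem_mem hj
    · intro hp
      obtain ⟨j, hj, rfl⟩ := List.mem_iff_getElem.1 hp
      exact ⟨j + 1, Finset.mem_Icc.2 (by omega), (hpoly j hj).symm⟩
  · obtain ⟨j, hj, rfl⟩ := hidx l hl
    rw [hpoly j hj]
    exact fun h => h0 (h ▸ List.getElem_mem hj)

theorem records_singleton (hf : f ≠ 0) :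
    Records ord (Ideal.span {f}) (⟨[((0, 1), makeMonic ord f)], [[]]⟩ : State n K) {1} := by
  have hpolys : (⟨[((0, 1), makeMonic ord f)], [[]]⟩ : State n K).polys {1} = {makeMonic ord f} := by
    ext p
    simp [State.polys, State.poly, entry]
  refine ⟨by simp [State.size], rfl, by simp [State.sig, entry], by simp [entry], ?_, ?_⟩
  · rw [hpolys, ← span_singleton_makeMonic (ord := ord)]
    exact isGroebnerBasis_singleton (makeMonic_eq_zero.not.2 hf)
  · simpa [State.poly, entry, makeMonic_eq_zero] using hf

theorem Records.callData (h : Records ord I st prev) (hf : f ≠ 0) :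
    CallData ord I (makeMonic ord f) (st.size + 1) prev
      { pushInput ord st f with rules := st.rules ++ [[]] } := by
  set st₀ : State n K := { pushInput ord st f with rules := st.rules ++ [[]] } with hst₀
  have hmem : ∀ l ∈ prev, 1 ≤ l ∧ l ≤ st.size := fun l hl => Finset.mem_Icc.1 (h.prev_eq ▸ hl)
  have hlp : ∀ l ∈ prev, entry st₀.lp (0, 0) l = entry st.lp (0, 0) l :=
    fun l hl => entry_append_of_le _ _ _ (hmem l hl).2
  have hsig : ∀ l ∈ prev, st₀.sig l = st.sig l := fun l hl => congrArg Prod.fst (hlp l hl)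
  have hpoly : ∀ l ∈ prev, st₀.poly l = st.poly l := fun l hl => congrArg Prod.snd (hlp l hl)
  have hlast : entry st₀.lp (0, 0) (st.size + 1) = ((0, st.size + 1), makeMonic ord f) :=
    entry_append_length_succ _ _ _
  constructor
  · omega
  · simp [hst₀, pushInput, State.append, State.size]
  · simp [hst₀, h.length_rules]
  · exact congrArg Prod.fst hlast
  · exact congrArg Prod.snd hlast
  · exact makeMonic_eq_zero.not.2 hf
  · rw [← h.length_rules]
    exact entry_append_length_succ _ _ _
  · exact fun l hl => (hmem l hl).1
  · exact fun l hl => Nat.lt_succ_of_le (hmem l hl).2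
  · intro l hl
    rw [hsig l hl, h.sig_eq l hl]
  · intro l hl
    rw [hpoly l hl]
    exact h.groebner.2.1 ⟨l, hl, rfl⟩
  · intro l hl
    rw [hpoly l hl]
    exact h.ne_zero l hl
  · intro b hb hb0
    obtain ⟨_, ⟨l, hl, rfl⟩, -, hle⟩ := h.groebner.2.2.2 b hb hb0
    exact ⟨l, hl, by rwa [hpoly l hl]⟩
  · intro l hl ρ hρ
    have he : entry st₀.rules [] l = entry st.rules [] l :=
      entry_append_of_le _ _ _ (by rw [h.length_rules]; exact (hmem l hl).2)
    rw [he] at hρ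
    obtain ⟨l', hl', hlt, hv⟩ := h.rules_eq l hl ρ hρ
    refine ⟨l', hl', hlt, ?_⟩
    rwa [hpoly l hl, hpoly l' hl']

theorem Records.partialBasis (h : Records ord I st prev) (hf : f ≠ 0)
    {B : Set (MvPolynomial (Fin n) K)} (hB : ∀ q ∈ B, q ∈ I)
    (hBhead : ∀ l ∈ prev, ∃ q ∈ B, q ≠ 0 ∧ ord.degree q = ord.degree (st.poly l))
    {st' : State n K} {out : Finset ℕ}
    (hp : PartialBasis ord (st.size + 1) B prev (pushInput ord st f) st' out) :
    IsGroebnerBasis ord (st'.polys out) (I ⊔ Ideal.span {f}) ∧ 0 ∉ st'.polys out := by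
  have D := h.callData hf
  have hpoly : ∀ l ∈ prev, ({ pushInput ord st f with rules := st.rules ++ [[]] } :
      State n K).poly l = st.poly l := fun l hl =>
    congrArg Prod.snd (entry_append_of_le st.lp ((0, st.size + 1), makeMonic ord f) (0, 0)
      (Nat.lt_succ_iff.1 (D.lt l hl)))
  have hsize : (pushInput ord st f).size = st.size + 1 := D.size
  rw [PartialBasis, hsize] at hp
  rw [← span_singleton_makeMonic (ord := ord)]
  refine isGroebnerBasis_partialBasis D ?_ hB (fun l hl => ?_) hp
  · rw [← h.groebner.2.2.1]
    congr 1
    ext p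
    exact exists_congr fun k => and_congr_right fun hk => by rw [hpoly k hk]
  · rw [hpoly l hl]
    exact hBhead l hl

theorem entry_mem {α : Type*} {l : List α} {d : α} {i : ℕ} (hi : 1 ≤ i) (hil : i ≤ l.length) :
    entry l d i ∈ l := by
  obtain ⟨i, rfl⟩ := Nat.exists_eq_add_of_le' hi
  have h : entry l d (i + 1) = l[i] := List.getD_eq_getElem l d hil
  exact h ▸ List.getElem_mem _

theorem span_take_succ {F : List (MvPolynomial (Fin n) K)} {i : ℕ} (hi : i < F.length) :
    Ideal.span {f | f ∈ F.take i} ⊔ Ideal.span {entry F 0 (i + 1)} =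
      Ideal.span {f | f ∈ F.take (i + 1)} := by
  rw [← Ideal.span_union]
  congr 1
  ext p
  have h : entry F 0 (i + 1) = F[i] := List.getD_eq_getElem F 0 hi
  rw [h, List.take_add_one, List.getElem?_eq_getElem hi]
  simp only [Set.mem_union, Set.mem_ofPred_eq, Set.mem_singleton_iff, List.mem_append,
    Option.toList_some, List.mem_singleton]

/-- The invariant of the main loop. -/
theorem AtLoop.invariant {F : List (MvPolynomial (Fin n) K)} (hF : ∀ f ∈ F, f ≠ 0) {i : ℕ}
    {B : Set (MvPolynomial (Fin n) K)} (h : AtLoop ord F i st prev B) :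
    2 ≤ i ∧ i ≤ F.length + 1 ∧ Records ord (Ideal.span {f | f ∈ F.take (i - 1)}) st prev ∧
      IsGroebnerBasis ord B (Ideal.span {f | f ∈ F.take (i - 1)}) ∧
      ∀ l ∈ prev, ∃ q ∈ B, q ≠ 0 ∧ ord.degree q = ord.degree (st.poly l) := by
  induction h with
  | start f₁ hf₁ =>
    obtain ⟨F', rfl⟩ : ∃ F', F = f₁ :: F' := by
      cases F with
      | nil => simp at hf₁
      | cons a F' =>
        obtain rfl : a = f₁ := by simpa using hf₁
        exact ⟨F', rfl⟩
    have hf : f₁ ≠ 0 := hF f₁ (by simp)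
    have hset : {f | f ∈ (f₁ :: F').take (2 - 1)} = {f₁} := by
      ext p
      simp
    rw [hset]
    refine ⟨le_rfl, by simp, records_singleton hf, isGroebnerBasis_singleton hf, fun l hl => ?_⟩
    obtain rfl := Finset.mem_singleton.1 hl
    -- `B` holds `f₁` itself and the list its monic multiple; the heads agree.
    refine ⟨f₁, rfl, hf, ?_⟩
    simp [State.poly, entry, degree_makeMonic]
  | next i st st₁ st₂ prev cur prev₂ B _ hi hp _ hs ih =>
    obtain ⟨h2, -, hrec, hB, hBhead⟩ := ih
    obtain ⟨i, rfl⟩ : ∃ j, i = j + 1 := ⟨i - 1, by omega⟩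
    have := hrec.partialBasis (hF _ (entry_mem (by omega) hi)) (fun q hq => hB.2.1 hq) hBhead hp
    rw [Nat.add_sub_cancel, span_take_succ (by omega)] at this
    obtain ⟨L, hL, rfl, rfl⟩ := hs
    obtain ⟨hLG, hL0⟩ := this.1.interreduction this.2 hL
    have hrec₂ := records_reducedState hLG hL0
    refine ⟨by omega, by omega, hrec₂, hrec₂.groebner, fun l hl => ?_⟩
    exact ⟨_, ⟨l, hl, rfl⟩, hrec₂.ne_zero l hl, rfl⟩

theorem CallReturns.isGroebnerBasis {F : List (MvPolynomial (Fin n) K)} (hF : ∀ f ∈ F, f ≠ 0)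
    {i : ℕ} {cur : Finset ℕ} (h : CallReturns ord F i st cur) :
    IsGroebnerBasis ord (st.polys cur) (Ideal.span {f | f ∈ F.take i}) := by
  obtain ⟨st₀, prev, B, hloop, hi, hp⟩ := h
  obtain ⟨h2, -, hrec, hB, hBhead⟩ := hloop.invariant hF
  obtain ⟨i, rfl⟩ : ∃ j, i = j + 1 := ⟨i - 1, by omega⟩
  have := hrec.partialBasis (hF _ (entry_mem (by omega) hi)) (fun q hq => hB.2.1 hq) hBhead hp
  rw [Nat.add_sub_cancel, span_take_succ (by omega)] at this
  exact this.1

theorem SortedReturns.isGroebnerBasis {F : List (MvPolynomial (Fin n) K)} (hF : ∀ f ∈ F, f ≠ 0)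
    {G : Set (MvPolynomial (Fin n) K)} (h : SortedReturns ord F G) :
    IsGroebnerBasis ord G (Ideal.span {f | f ∈ F}) := by
  cases h with
  | one i st cur hcall hone =>
    obtain ⟨k, hk, hk1⟩ := hone
    have h1 : (1 : MvPolynomial (Fin n) K) ∈ Ideal.span {f | f ∈ F} := by
      refine Ideal.span_mono (fun f hf => List.mem_of_mem_take hf)
        ((hcall.isGroebnerBasis hF).2.1 ⟨k, hk, hk1.symm⟩)
    -- A unit in the ideal of the first `i` inputs already makes the ideal of all inputs the whole
    -- ring, so the early return is correct.
    have htop : Ideal.span {f | f ∈ F} = Ideal.span {1} := by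
      rw [(Ideal.eq_top_iff_one _).2 h1, Ideal.span_singleton_one]
    rw [htop]
    exact isGroebnerBasis_singleton one_ne_zero
  | finish i st prev _ hloop hi =>
    obtain ⟨-, hi', -, hB, -⟩ := hloop.invariant hF
    rwa [List.take_of_length_le (by omega)] at hB

end MainLoop

end F5C

theorem mainTheorem3 {K : Type*} [Field K] {n : ℕ} (ord : MonomialOrder (Fin n))
    (F : List (MvPolynomial (Fin n) K))
    (hF : ∀ f ∈ F, f ≠ 0 ∧ ∃ d : ℕ, f.IsHomogeneous d) :
    (∀ F' : List (MvPolynomial (Fin n) K), F5C.IsSorting ord F F' →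
      ∀ (i : ℕ) (st : F5C.State n K) (cur : Finset ℕ), F5C.CallReturns ord F' i st cur →
        F5C.IsGroebnerBasis ord (st.polys cur) (Ideal.span {f | f ∈ F'.take i})) ∧
    (∀ G : Set (MvPolynomial (Fin n) K), F5C.Returns ord F G →
      F5C.IsGroebnerBasis ord G (Ideal.span {f | f ∈ F})) := by
  have hne : ∀ F' : List (MvPolynomial (Fin n) K), F5C.IsSorting ord F F' → ∀ f ∈ F', f ≠ 0 :=
    fun F' hF' f hf => (hF f (hF'.1.mem_iff.1 hf)).1
  refine ⟨fun F' hF' i st cur h => h.isGroebnerBasis (hne F' hF'), ?_⟩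
  rintro G ⟨F', hF', h⟩
  have hset : {f | f ∈ F} = {f | f ∈ F'} := Set.ext fun f => hF'.1.mem_iff.symm
  rw [hset]
  exact h.isGroebnerBasis (hne F' hF')
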